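/- Let $L>0$ and write $Q_T=(0,T)\times(-L,L)$; all functions are complex valued. For $\tau>0$ let $\mathscr R_L(\tau)$ be the set of all $f\in L^2(-L,L)$ for which there are controls $v_-,v_+\in L^2(0,\tau)$ such that the solution $u\in L^2(Q_\tau)$ (in the sense of transposition) of $$\partial_t u-\partial_{xx}u=0 \text{ in } Q_\tau,\qquad u(t,-L)=v_-(t),\quad u(t,L)=v_+(t) \text{ in } (0,\tau),\qquad u(0,\cdot)=0 \text{ in } (-L,L)$$ satisfies $u(\tau,\cdot)=f$. The set $\mathscr R_L(\tau)$ is known not to depend on $\tau>0$; the reachable set $\mathscr R_L$ is this common set, $\mathscr R_L=\bigcap_{\tau>0}\mathscr R_L(\tau)$. Let $T$ satisfy $\pi T>L^2$, let $g\in L^2\big((0,\infty)\times(-L,L)\big)$ be such that $$\int_0^\infty\int_{-L}^{L}|g(t,x)|^2\exp\Big(\frac{L^2-x^2}{2t}\Big)\,dx\,dt<\infty ,$$ and let $w_T\in L^2(-L,L)$. If $w\in C([0,T];L^2(-L,L))$ denotes the solution of $$-\partial_t w-\partial_{xx}w=g \text{ in } Q_T,\qquad w(t,-L)=w(t,L)=0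 \text{ in } (0,T),\qquad w(T,\cdot)=w_T \text{ in } (-L,L),$$ then $w(0,\cdot)\in\mathscr R_L$, that is, $w(0,\cdot)\in\mathscr R_L(\tau)$ for every $\tau>0$. -/

import Mathlib

open MeasureTheory Set
open scoped ContDiff

noncomputable section

namespace HeatReach

/-- Lebesgue measure on the interval `(-L, L)`. -/
abbrev intervalMeasure (L : ℝ) : Measure ℝ := volume.restrict (Ioo (-L) L)

/-- The complex Hilbert space `L²(-L, L)`. -/
abbrev State (L : ℝ) : Type := Lp ℂ 2 (intervalMeasure L)

/-- `∂ₜ φ (t, x)`. -/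
def dt (φ : ℝ × ℝ → ℂ) (t x : ℝ) : ℂ := deriv (fun s => φ (s, x)) t

/-- `∂ₓ φ (t, x)`. -/
def dx (φ : ℝ × ℝ → ℂ) (t x : ℝ) : ℂ := deriv (fun y => φ (t, y)) x

/-- `∂ₓₓ φ (t, x)`. -/
def dxx (φ : ℝ × ℝ → ℂ) (t x : ℝ) : ℂ := iteratedDeriv 2 (fun y => φ (t, y)) x

/-- Test functions for the Dirichlet problem on `[0, T] × [-L, L]`: smooth functions of `(t, x)`
that vanish on the lateral boundary. Nothing is imposed at `t = 0`, at `t = T`, or on the normal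
derivatives at `x = ± L`. -/
structure IsTest (L T : ℝ) (φ : ℝ × ℝ → ℂ) : Prop where
  smooth : ContDiff ℝ ∞ φ
  left : ∀ t ∈ Icc 0 T, φ (t, -L) = 0
  right : ∀ t ∈ Icc 0 T, φ (t, L) = 0

/-- `u ∈ L²((0,T) × (-L,L))` is the solution (in the sense of transposition) of the boundary
controlled heat equation `∂ₜ u - ∂ₓₓ u = 0` in `(0,T) × (-L,L)`, `u(t,-L) = vm(t)`,
`u(t,L) = vp(t)`, `u(0,·) = 0`, and its value at time `T` is `uT`. The identity is what one gets by
multiplying the equation by `φ` and integrating by parts; it encodes the equation, both boundary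
conditions, the zero initial condition and the final value. -/
structure IsControlledSolution (L T : ℝ) (vm vp : ℝ → ℂ) (u : ℝ × ℝ → ℂ) (uT : State L) :
    Prop where
  memLp : MemLp u 2 (volume.restrict (Ioo 0 T ×ˢ Ioo (-L) L))
  identity : ∀ φ : ℝ × ℝ → ℂ, IsTest L T φ →
    (∫ x in Ioo (-L) L, uT x * φ (T, x)) +
        ∫ p in Ioo 0 T ×ˢ Ioo (-L) L, u p * (-dt φ p.1 p.2 - dxx φ p.1 p.2) =
      ∫ t in Ioo 0 T, (vm t * dx φ t (-L) - vp t * dx φ t L)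

/-- The set `R_L(T)` of the states in `L²(-L,L)` that are reached at time `T`, from the zero
state, with controls in `L²(0,T)` at both ends. -/
def reachableSetAt (L T : ℝ) : Set (State L) :=
  {f | ∃ vm vp : ℝ → ℂ,
    MemLp vm 2 (volume.restrict (Ioo 0 T)) ∧ MemLp vp 2 (volume.restrict (Ioo 0 T)) ∧
      ∃ u : ℝ × ℝ → ℂ, IsControlledSolution L T vm vp u f}

/-- The reachable set `R_L`. The sets `R_L(τ)`, `τ > 0`, all coincide by null controllability in
arbitrarily small time; since this is not used here, `R_L` is taken to be their intersection, so
that membership means being reachable in every time horizon. -/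
def reachableSet (L : ℝ) : Set (State L) := ⋂ τ : ℝ, ⋂ _ : 0 < τ, reachableSetAt L τ

/-- `w ∈ C([0,T]; L²(-L,L))` is the solution of the backward problem `-∂ₜ w - ∂ₓₓ w = g` in
`(0,T) × (-L,L)`, `w(t,-L) = w(t,L) = 0`, `w(T,·) = wT`. The equation and the homogeneous
boundary conditions are expressed by integrating by parts against test functions whose normal
derivatives at `x = ± L` are arbitrary. -/
structure IsBackwardSolution (L T : ℝ) (g : ℝ × ℝ → ℂ) (wT : State L) (w : ℝ → State L) :
    Prop where
  continuousOn : ContinuousOn w (Icc 0 T)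
  final : w T = wT
  identity : ∀ φ : ℝ × ℝ → ℂ, IsTest L T φ →
    ∫ t in Ioo 0 T, ∫ x in Ioo (-L) L, w t x * (dt φ t x - dxx φ t x) =
      (∫ p in Ioo 0 T ×ˢ Ioo (-L) L, g p * φ p) +
        (∫ x in Ioo (-L) L, wT x * φ (T, x)) - ∫ x in Ioo (-L) L, w 0 x * φ (0, x)

end HeatReach

end

/-!
A state `f` is reachable at time `τ` once `|∫ f φ(τ, ·)|` is bounded by the `L²` norms of the normal
derivatives of `φ` at `±L` and of `-∂ₜφ - ∂ₓₓφ`, for all test functions `φ`: the Riesz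
representation theorem then provides the controls and the solution. For `f = w(0, ·)`, put
`ψ(t, x) = φ(τ - t, x)` and test the equation of `w` against `χ ψ`, with `χ` a cutoff in time, equal
to `1` near `0`. Everything reduces to estimating `g χ ψ` and `χ' ψ`. As `χ'` is supported away from
`t = 0` and `g` is small near `t = 0`, it is enough to bound `ψ exp (-(L² - x²) / (4 t))` in
`L²`. This weight is a Carleman weight: conjugation by it turns the heat operator into one whose
energy, multiplied by `t²`, grows only through the boundary terms and the source, and the `L²` norm
is bounded by this energy and by `ψ` at the final time. A second weight, centred outside `(-L, L)`,
dissipates enough energy to bound `ψ` at the final time as well.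
-/

noncomputable section

namespace HeatReach

open Filter
open scoped InnerProductSpace Topology

section Partials

theorem hasDerivAt_comp_fst {E : Type*} [NormedAddCommGroup E] [NormedSpace ℝ E]
    {f : ℝ × ℝ → E} {p : ℝ × ℝ} (hf : DifferentiableAt ℝ f p) :
    HasDerivAt (fun s => f (s, p.2)) (fderiv ℝ f p (1, 0)) p.1 :=
  hf.hasFDerivAt.comp_hasDerivAt (f := fun s : ℝ => (s, p.2)) p.1
    ((hasDerivAt_id p.1).prodMk (hasDerivAt_const p.1 p.2))

theorem hasDerivAt_comp_snd {E : Type*} [NormedAddCommGroup E] [NormedSpace ℝ E]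
    {f : ℝ × ℝ → E} {p : ℝ × ℝ} (hf : DifferentiableAt ℝ f p) :
    HasDerivAt (fun y => f (p.1, y)) (fderiv ℝ f p (0, 1)) p.2 :=
  hf.hasFDerivAt.comp_hasDerivAt (f := fun y : ℝ => (p.1, y)) p.2
    ((hasDerivAt_const p.2 p.1).prodMk (hasDerivAt_id p.2))

variable {ψ : ℝ × ℝ → ℂ} {p : ℝ × ℝ}

theorem dt_eq_fderiv (hψ : DifferentiableAt ℝ ψ p) : dt ψ p.1 p.2 = fderiv ℝ ψ p (1, 0) :=
  (hasDerivAt_comp_fst hψ).deriv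

theorem dx_eq_fderiv (hψ : DifferentiableAt ℝ ψ p) : dx ψ p.1 p.2 = fderiv ℝ ψ p (0, 1) :=
  (hasDerivAt_comp_snd hψ).deriv

theorem hasDerivAt_dt (hψ : DifferentiableAt ℝ ψ p) :
    HasDerivAt (fun s => ψ (s, p.2)) (dt ψ p.1 p.2) p.1 :=
  (hasDerivAt_comp_fst hψ).differentiableAt.hasDerivAt

theorem hasDerivAt_dx (hψ : DifferentiableAt ℝ ψ p) :
    HasDerivAt (fun y => ψ (p.1, y)) (dx ψ p.1 p.2) p.2 :=
  (hasDerivAt_comp_snd hψ).differentiableAt.hasDerivAt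

theorem eventually_differentiableAt (hψ : ContDiffAt ℝ 1 ψ p) :
    ∀ᶠ q in 𝓝 p, DifferentiableAt ℝ ψ q :=
  (hψ.eventually (by simp)).mono fun _ hq => hq.differentiableAt one_ne_zero

theorem dt_eventuallyEq (hψ : ContDiffAt ℝ 1 ψ p) :
    (fun q => dt ψ q.1 q.2) =ᶠ[𝓝 p] fun q => fderiv ℝ ψ q (1, 0) :=
  (eventually_differentiableAt hψ).mono fun _ => dt_eq_fderiv

theorem dx_eventuallyEq (hψ : ContDiffAt ℝ 1 ψ p) :
    (fun q => dx ψ q.1 q.2) =ᶠ[𝓝 p] fun q => fderiv ℝ ψ q (0, 1) :=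
  (eventually_differentiableAt hψ).mono fun _ => dx_eq_fderiv

theorem contDiffAt_dt (hψ : ContDiffAt ℝ ∞ ψ p) :
    ContDiffAt ℝ ∞ (fun q => dt ψ q.1 q.2) p :=
  ((hψ.fderiv_right (m := ∞) le_rfl).clm_apply contDiffAt_const).congr_of_eventuallyEq
    (dt_eventuallyEq (hψ.of_le (by simp)))

theorem contDiffAt_dx (hψ : ContDiffAt ℝ ∞ ψ p) :
    ContDiffAt ℝ ∞ (fun q => dx ψ q.1 q.2) p :=
  ((hψ.fderiv_right (m := ∞) le_rfl).clm_apply contDiffAt_const).congr_of_eventuallyEq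
    (dx_eventuallyEq (hψ.of_le (by simp)))

theorem dxx_eq_dx_dx (ψ : ℝ × ℝ → ℂ) (t x : ℝ) :
    dxx ψ t x = dx (fun q => dx ψ q.1 q.2) t x := by
  simp only [dxx, dx, iteratedDeriv_succ, iteratedDeriv_zero]

theorem contDiffAt_dxx (hψ : ContDiffAt ℝ ∞ ψ p) :
    ContDiffAt ℝ ∞ (fun q => dxx ψ q.1 q.2) p := by
  simpa only [dxx_eq_dx_dx] using contDiffAt_dx (contDiffAt_dx hψ)

theorem hasDerivAt_dxx (hψ : ContDiffAt ℝ ∞ ψ p) :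
    HasDerivAt (fun y => dx ψ p.1 y) (dxx ψ p.1 p.2) p.2 := by
  simpa only [dxx_eq_dx_dx] using
    hasDerivAt_dx ((contDiffAt_dx hψ).differentiableAt (by simp))

theorem dt_dx_comm (hψ : ContDiffAt ℝ ∞ ψ p) :
    dt (fun q => dx ψ q.1 q.2) p.1 p.2 = dx (fun q => dt ψ q.1 q.2) p.1 p.2 := by
  have hψ' : DifferentiableAt ℝ (fderiv ℝ ψ) p :=
    (hψ.fderiv_right (m := ∞) le_rfl).differentiableAt (by simp)
  rw [dt_eq_fderiv ((contDiffAt_dx hψ).differentiableAt (by simp)),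
    dx_eq_fderiv ((contDiffAt_dt hψ).differentiableAt (by simp)),
    (dx_eventuallyEq (hψ.of_le (by simp))).fderiv_eq,
    (dt_eventuallyEq (hψ.of_le (by simp))).fderiv_eq,
    fderiv_clm_apply hψ' (differentiableAt_const _),
    fderiv_clm_apply hψ' (differentiableAt_const _)]
  simpa using (hψ.isSymmSndFDerivAt (by simp [ENat.LEInfty.out])).eq (1, 0) (0, 1)

end Partials

/-- The closed space-time rectangle `[a, b] × [-L, L]`. -/
abbrev rect (L a b : ℝ) : Set (ℝ × ℝ) := Icc a b ×ˢ Icc (-L) L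

section Rect

variable {L a b : ℝ}

theorem isCompact_rect (L a b : ℝ) : IsCompact (rect L a b) := isCompact_Icc.prod isCompact_Icc

theorem integrableOn_rect {E : Type*} [NormedAddCommGroup E] {f : ℝ × ℝ → E}
    (hf : ∀ p ∈ rect L a b, ContinuousAt f p) : IntegrableOn f (rect L a b) :=
  ContinuousOn.integrableOn_compact (isCompact_rect L a b)
    fun p hp => (hf p hp).continuousWithinAt

theorem integral_sub_integral_le_of_divergence_le (hL : 0 ≤ L) (hab : a ≤ b)
    {e P R : ℝ × ℝ → ℝ}
    (he : ∀ p ∈ rect L a b, ContDiffAt ℝ 1 e p) (hP : ∀ p ∈ rect L a b, ContDiffAt ℝ 1 P p)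
    (hR : IntegrableOn R (rect L a b))
    (h : ∀ p ∈ rect L a b,
      deriv (fun t => e (t, p.2)) p.1 - deriv (fun x => P (p.1, x)) p.2 ≤ R p) :
    (∫ x in -L..L, e (b, x)) - (∫ x in -L..L, e (a, x)) ≤
      (∫ t in a..b, (P (t, L) - P (t, -L))) + ∫ p in rect L a b, R p := by
  have hLL : -L ≤ L := neg_le_self hL
  have hrect : Icc (a, -L) (b, L) = rect L a b := (Icc_prod_Icc a b (-L) L).symm
  have hdiff {f : ℝ × ℝ → ℝ} (hf : ∀ p ∈ rect L a b, ContDiffAt ℝ 1 f p) (p) (hp : p ∈ rect L a b) :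
      HasFDerivAt f (fderiv ℝ f p) p := ((hf p hp).differentiableAt one_ne_zero).hasFDerivAt
  have hint {f : ℝ × ℝ → ℝ} (hf : ∀ p ∈ rect L a b, ContDiffAt ℝ 1 f p) (v : ℝ × ℝ) :
      IntegrableOn (fun p => fderiv ℝ f p v) (rect L a b) :=
    integrableOn_rect fun p hp =>
      (((hf p hp).fderiv_right (m := 0) le_rfl).clm_apply contDiffAt_const).continuousAt
  have hinterval {f : ℝ × ℝ → ℝ} (hf : ∀ p ∈ rect L a b, ContDiffAt ℝ 1 f p) {x : ℝ}
      (hx : x ∈ Icc (-L) L) : IntervalIntegrable (fun t => f (t, x)) volume a b := by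
    refine ContinuousOn.intervalIntegrable fun t ht => ContinuousAt.continuousWithinAt ?_
    rw [uIcc_of_le hab] at ht
    exact (hf (t, x) ⟨ht, hx⟩).continuousAt.comp (f := fun t => (t, x)) (by fun_prop)
  have key := integral_divergence_prod_Icc_of_hasFDerivAt_of_le e (fun p => -P p)
    (fderiv ℝ e) (fun p => -fderiv ℝ P p) (a, -L) (b, L) ⟨hab, hLL⟩
    (by rw [hrect]; exact fun p hp => (he p hp).continuousAt.continuousWithinAt)
    (by rw [hrect]; exact fun p hp => (hP p hp).continuousAt.neg.continuousWithinAt)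
    (fun p hp => hdiff he p ⟨Ioo_subset_Icc_self hp.1, Ioo_subset_Icc_self hp.2⟩)
    (fun p hp => (hdiff hP p ⟨Ioo_subset_Icc_self hp.1, Ioo_subset_Icc_self hp.2⟩).neg)
    (by rw [hrect]; exact (hint he _).add (hint hP _).neg)
  have hle : ∫ p in rect L a b, (fderiv ℝ e p (1, 0) + (-fderiv ℝ P p) (0, 1)) ≤
      ∫ p in rect L a b, R p := by
    refine setIntegral_mono_on ((hint he _).add (hint hP _).neg) hR
      (isCompact_rect L a b).measurableSet fun p hp => ?_
    have het := hasDerivAt_comp_fst (hdiff he p hp).differentiableAt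
    have hPx := hasDerivAt_comp_snd (hdiff hP p hp).differentiableAt
    simpa only [neg_apply, het.deriv, hPx.deriv, sub_eq_add_neg] using h p hp
  rw [hrect] at key
  rw [intervalIntegral.integral_sub (hinterval hP ⟨hLL, le_rfl⟩) (hinterval hP ⟨le_rfl, hLL⟩)]
  simp only [intervalIntegral.integral_neg] at key
  linarith

end Rect

/-- The heat operator `∂ₜ - ∂ₓₓ`, as a function of the space-time point. -/
def heat (ψ : ℝ × ℝ → ℂ) (p : ℝ × ℝ) : ℂ := dt ψ p.1 p.2 - dxx ψ p.1 p.2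

/-- The parameters of the Carleman weight `exp (-φ)` with phase
`φ(t, x) = m (R² - (x + x₀)²) / (4 t) + c t`. -/
structure Carleman where
  /-- The factor of the self-similar part of the phase. -/
  m : ℕ
  /-- The distance to the centre at which the self-similar part of the phase vanishes. -/
  R : ℝ
  /-- The rate of the additional exponential decay in time. -/
  c : ℝ
  /-- The opposite of the centre of the weight. -/
  x₀ : ℝ

namespace Carleman

variable (W : Carleman) {ψ θ : ℝ × ℝ → ℂ} {p : ℝ × ℝ}

/-- The phase of a Carleman weight. -/
def phase (p : ℝ × ℝ) : ℝ := W.m * (W.R ^ 2 - (p.2 + W.x₀) ^ 2) / (4 * p.1) + W.c * p.1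

/-- The weight `exp (-φ)`. -/
def weight (p : ℝ × ℝ) : ℝ := Real.exp (-W.phase p)

/-- The potential `∂ₜφ - (∂ₓφ)²` of the conjugated heat operator. -/
def potential (p : ℝ × ℝ) : ℝ :=
  W.c - (W.m * W.R ^ 2 + (W.m ^ 2 - W.m) * (p.2 + W.x₀) ^ 2) / (4 * p.1 ^ 2)

/-- The coefficient `-(∂ₜV + (m (x + x₀) / t) ∂ₓV + (2 m / t) V)`, with `V` the potential, of
`|θ|²` in the dissipation of the weighted energy. -/
def dissipation (p : ℝ × ℝ) : ℝ :=
  W.m * (W.m - 1) * (W.R ^ 2 + (2 * W.m - 1) * (p.2 + W.x₀) ^ 2) / (2 * p.1 ^ 3) -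
    2 * W.m * W.c / p.1

/-- The conjugated function `exp (-φ) ψ`. -/
def conj (ψ : ℝ × ℝ → ℂ) (p : ℝ × ℝ) : ℂ := W.weight p • ψ p

/-- The heat operator conjugated by the weight: `exp (-φ) (∂ₜ - ∂ₓₓ) exp φ`. -/
def conjHeat (θ : ℝ × ℝ → ℂ) (p : ℝ × ℝ) : ℂ :=
  heat θ p + W.potential p • θ p + (W.m * (p.2 + W.x₀) / p.1) • dx θ p.1 p.2 +
    (W.m / (2 * p.1)) • θ p

theorem weight_pos (p : ℝ × ℝ) : 0 < W.weight p := Real.exp_pos _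

theorem weight_sq (p : ℝ × ℝ) : W.weight p ^ 2 = Real.exp (-(2 * W.phase p)) := by
  rw [weight, ← Real.exp_nat_mul]
  push_cast
  ring_nf

theorem measurable_weight : Measurable W.weight := by
  unfold weight phase
  fun_prop

theorem contDiffAt_weight (hp : p.1 ≠ 0) : ContDiffAt ℝ ∞ W.weight p := by
  have h4 : 4 * p.1 ≠ 0 := by positivity
  unfold weight phase
  fun_prop (disch := assumption)

theorem contDiffAt_potential (hp : p.1 ≠ 0) : ContDiffAt ℝ ∞ W.potential p := by
  have h4 : 4 * p.1 ^ 2 ≠ 0 := by positivity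
  unfold potential
  fun_prop (disch := assumption)

theorem contDiffAt_conj (hp : p.1 ≠ 0) (hψ : ContDiffAt ℝ ∞ ψ p) :
    ContDiffAt ℝ ∞ (W.conj ψ) p :=
  (W.contDiffAt_weight hp).smul hψ

theorem continuousAt_conjHeat (hp : p.1 ≠ 0) (hθ : ContDiffAt ℝ ∞ θ p) :
    ContinuousAt (W.conjHeat θ) p := by
  have h2 : 2 * p.1 ≠ 0 := by positivity
  have hV := (W.contDiffAt_potential hp).continuousAt
  have hdt := (contDiffAt_dt hθ).continuousAt
  have hdx := (contDiffAt_dx hθ).continuousAt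
  have hdxx := (contDiffAt_dxx hθ).continuousAt
  have hθ := hθ.continuousAt
  unfold conjHeat heat
  fun_prop (disch := assumption)

theorem hasDerivAt_weight_fst (hp : p.1 ≠ 0) :
    HasDerivAt (fun t => W.weight (t, p.2))
      (W.weight p * (W.m * (W.R ^ 2 - (p.2 + W.x₀) ^ 2) / (4 * p.1 ^ 2) - W.c)) p.1 := by
  have h : HasDerivAt (fun t => -W.phase (t, p.2))
      (W.m * (W.R ^ 2 - (p.2 + W.x₀) ^ 2) / (4 * p.1 ^ 2) - W.c) p.1 := by
    refine (((hasDerivAt_const p.1 (W.m * (W.R ^ 2 - (p.2 + W.x₀) ^ 2) : ℝ)).div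
      ((hasDerivAt_id p.1).const_mul 4) (by simpa)).add
      ((hasDerivAt_id p.1).const_mul W.c)).neg.congr_deriv ?_
    simp only [id]
    field_simp
    ring
  exact h.exp

theorem hasDerivAt_weight_snd (p : ℝ × ℝ) :
    HasDerivAt (fun x => W.weight (p.1, x))
      (W.weight p * (W.m * (p.2 + W.x₀) / (2 * p.1))) p.2 := by
  have h : HasDerivAt (fun x => -W.phase (p.1, x)) (W.m * (p.2 + W.x₀) / (2 * p.1)) p.2 := by
    refine ((((((hasDerivAt_id p.2).add_const W.x₀).pow 2).const_sub (W.R ^ 2)).const_mul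
      (W.m : ℝ)).div_const (4 * p.1) |>.add_const (W.c * p.1)).neg.congr_deriv ?_
    simp only [id]
    ring
  exact h.exp

theorem hasDerivAt_potential_fst (hp : p.1 ≠ 0) :
    HasDerivAt (fun t => W.potential (t, p.2))
      ((W.m * W.R ^ 2 + (W.m ^ 2 - W.m) * (p.2 + W.x₀) ^ 2) / (2 * p.1 ^ 3)) p.1 := by
  refine (((hasDerivAt_const p.1 (W.m * W.R ^ 2 + (W.m ^ 2 - W.m) * (p.2 + W.x₀) ^ 2 : ℝ)).div
    (((hasDerivAt_id p.1).pow 2).const_mul 4) (by simpa)).const_sub W.c).congr_deriv ?_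
  simp only [id, Pi.pow_apply]
  field_simp
  ring

theorem hasDerivAt_potential_snd (p : ℝ × ℝ) :
    HasDerivAt (fun x => W.potential (p.1, x))
      (-((W.m ^ 2 - W.m) * (p.2 + W.x₀)) / (2 * p.1 ^ 2)) p.2 := by
  refine (((((((hasDerivAt_id p.2).add_const W.x₀).pow 2).const_mul
    (W.m ^ 2 - W.m : ℝ)).const_add (W.m * W.R ^ 2)).div_const (4 * p.1 ^ 2)).const_sub
      W.c).congr_deriv ?_
  simp only [id]
  ring

theorem dt_conj (hp : p.1 ≠ 0) (hψ : DifferentiableAt ℝ ψ p) :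
    dt (W.conj ψ) p.1 p.2 = W.weight p •
      (dt ψ p.1 p.2 + (W.m * (W.R ^ 2 - (p.2 + W.x₀) ^ 2) / (4 * p.1 ^ 2) - W.c) • ψ p) := by
  refine ((W.hasDerivAt_weight_fst hp).smul (hasDerivAt_dt hψ)).deriv.trans ?_
  module

theorem dx_conj (hψ : DifferentiableAt ℝ ψ p) :
    dx (W.conj ψ) p.1 p.2 =
      W.weight p • (dx ψ p.1 p.2 + (W.m * (p.2 + W.x₀) / (2 * p.1)) • ψ p) := by
  refine ((W.hasDerivAt_weight_snd p).smul (hasDerivAt_dx hψ)).deriv.trans ?_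
  module

theorem dxx_conj (hψ : ContDiff ℝ ∞ ψ) (p : ℝ × ℝ) :
    dxx (W.conj ψ) p.1 p.2 = W.weight p •
      (dxx ψ p.1 p.2 + (W.m * (p.2 + W.x₀) / p.1) • dx ψ p.1 p.2 +
        (W.m / (2 * p.1) + (W.m * (p.2 + W.x₀) / (2 * p.1)) ^ 2) • ψ p) := by
  have hdiff := hψ.differentiable (by simp)
  have hcoef : HasDerivAt (fun x => W.m * (x + W.x₀) / (2 * p.1)) (W.m / (2 * p.1)) p.2 := by
    simpa using (((hasDerivAt_id p.2).add_const W.x₀).const_mul (W.m : ℝ)).div_const (2 * p.1)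
  have hdx : (fun x => dx (W.conj ψ) p.1 x) = fun x =>
      W.weight (p.1, x) • (dx ψ p.1 x + (W.m * (x + W.x₀) / (2 * p.1)) • ψ (p.1, x)) :=
    funext fun x => W.dx_conj (p := (p.1, x)) (hdiff _)
  rw [dxx_eq_dx_dx, dx, hdx]
  refine ((W.hasDerivAt_weight_snd p).smul ((hasDerivAt_dxx hψ.contDiffAt).add
    (hcoef.smul (hasDerivAt_dx (hdiff p))))).deriv.trans ?_
  simp only [Pi.add_apply, Pi.smul_apply']
  module

theorem conjHeat_conj (hp : p.1 ≠ 0) (hψ : ContDiff ℝ ∞ ψ) :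
    W.conjHeat (W.conj ψ) p = W.weight p • heat ψ p := by
  have hdiff := hψ.differentiable (by simp) p
  rw [conjHeat, heat, heat, W.dt_conj hp hdiff, W.dx_conj hdiff, W.dxx_conj hψ, conj, potential]
  match_scalars <;> field_simp <;> ring

end Carleman

section Energy

theorem two_mul_inner_sub_le {E : Type*} [NormedAddCommGroup E] [InnerProductSpace ℝ E]
    (h G : E) : 2 * ⟪h, G - h⟫_ℝ ≤ ‖G‖ ^ 2 / 2 := by
  have h₁ : ‖G - (2 : ℝ) • h‖ ^ 2 = ‖G‖ ^ 2 - 4 * ⟪h, G - h⟫_ℝ := by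
    rw [norm_sub_sq_real, norm_smul, inner_smul_right, inner_sub_right, real_inner_self_eq_norm_sq,
      real_inner_comm, mul_pow]
    norm_num
    ring
  linarith [sq_nonneg ‖G - (2 : ℝ) • h‖]

namespace Carleman

variable (W : Carleman) {θ ψ : ℝ × ℝ → ℂ} {p : ℝ × ℝ}

/-- The energy density `|∂ₓθ|² + V |θ|²`, with `V` the potential. -/
def energyDensity (θ : ℝ × ℝ → ℂ) (p : ℝ × ℝ) : ℝ :=
  ‖dx θ p.1 p.2‖ ^ 2 + W.potential p * ‖θ p‖ ^ 2

/-- The energy density weighted by `t ^ (2 m)`. -/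
def weightedEnergy (θ : ℝ × ℝ → ℂ) (p : ℝ × ℝ) : ℝ := p.1 ^ (2 * W.m) * W.energyDensity θ p

/-- The flux in the local conservation law for the weighted energy. -/
def energyFlux (θ : ℝ × ℝ → ℂ) (p : ℝ × ℝ) : ℝ :=
  p.1 ^ (2 * W.m) * (2 * ⟪dx θ p.1 p.2, dt θ p.1 p.2⟫_ℝ + W.m / p.1 *
    ((p.2 + W.x₀) * ‖dx θ p.1 p.2‖ ^ 2 - (p.2 + W.x₀) * W.potential p * ‖θ p‖ ^ 2 +
      ⟪dx θ p.1 p.2, θ p⟫_ℝ))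

theorem contDiffAt_energyDensity (hp : p.1 ≠ 0) (hθ : ContDiffAt ℝ ∞ θ p) :
    ContDiffAt ℝ ∞ (W.energyDensity θ) p :=
  ((contDiffAt_dx hθ).norm_sq ℝ).add ((W.contDiffAt_potential hp).mul (hθ.norm_sq ℝ))

theorem contDiffAt_weightedEnergy (hp : p.1 ≠ 0) (hθ : ContDiffAt ℝ ∞ θ p) :
    ContDiffAt ℝ ∞ (W.weightedEnergy θ) p :=
  (contDiffAt_fst.pow _).mul (W.contDiffAt_energyDensity hp hθ)

theorem contDiffAt_energyFlux (hp : p.1 ≠ 0) (hθ : ContDiffAt ℝ ∞ θ p) :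
    ContDiffAt ℝ ∞ (W.energyFlux θ) p := by
  have hV := W.contDiffAt_potential hp
  have hx := contDiffAt_dx hθ
  have hx_sq := hx.norm_sq ℝ
  have h_sq := hθ.norm_sq ℝ
  have hxt := hx.inner ℝ (contDiffAt_dt hθ)
  have hxθ := hx.inner ℝ hθ
  unfold energyFlux
  fun_prop (disch := assumption)

theorem hasDerivAt_weightedEnergy_fst (hp : p.1 ≠ 0) (hθ : ContDiffAt ℝ ∞ θ p) :
    HasDerivAt (fun t => W.weightedEnergy θ (t, p.2))
      (p.1 ^ (2 * W.m) * (2 * W.m / p.1 * W.energyDensity θ p +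
        2 * ⟪dx θ p.1 p.2, dx (fun q => dt θ q.1 q.2) p.1 p.2⟫_ℝ +
        (W.m * W.R ^ 2 + (W.m ^ 2 - W.m) * (p.2 + W.x₀) ^ 2) / (2 * p.1 ^ 3) * ‖θ p‖ ^ 2 +
        2 * W.potential p * ⟪θ p, dt θ p.1 p.2⟫_ℝ)) p.1 := by
  have hpow : HasDerivAt (fun t : ℝ => t ^ (2 * W.m)) (p.1 ^ (2 * W.m) * (2 * W.m / p.1)) p.1 := by
    refine (hasDerivAt_pow (2 * W.m) p.1).congr_deriv ?_
    rcases W.m.eq_zero_or_pos with hm | hm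
    · simp [hm]
    · rw [pow_sub₀ _ hp (by omega)]
      push_cast
      field_simp
  have hx : HasDerivAt (fun t => dx θ t p.2) (dx (fun q => dt θ q.1 q.2) p.1 p.2) p.1 := by
    rw [← dt_dx_comm hθ]
    exact hasDerivAt_dt ((contDiffAt_dx hθ).differentiableAt (by simp))
  refine (hpow.mul (hx.norm_sq.add ((W.hasDerivAt_potential_fst hp).mul
    (hasDerivAt_dt (hθ.differentiableAt (by simp))).norm_sq))).congr_deriv ?_
  simp only [energyDensity, Pi.add_apply, Pi.mul_apply]
  ring

theorem hasDerivAt_energyFlux_snd (hθ : ContDiffAt ℝ ∞ θ p) :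
    HasDerivAt (fun x => W.energyFlux θ (p.1, x))
      (p.1 ^ (2 * W.m) * (2 * ⟪dx θ p.1 p.2, dx (fun q => dt θ q.1 q.2) p.1 p.2⟫_ℝ +
        2 * ⟪dxx θ p.1 p.2, dt θ p.1 p.2⟫_ℝ + W.m / p.1 *
        (2 * ‖dx θ p.1 p.2‖ ^ 2 + 2 * (p.2 + W.x₀) * ⟪dx θ p.1 p.2, dxx θ p.1 p.2⟫_ℝ -
          (W.potential p - (W.m ^ 2 - W.m) * (p.2 + W.x₀) ^ 2 / (2 * p.1 ^ 2)) * ‖θ p‖ ^ 2 -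
          2 * (p.2 + W.x₀) * W.potential p * ⟪θ p, dx θ p.1 p.2⟫_ℝ +
          ⟪dxx θ p.1 p.2, θ p⟫_ℝ))) p.2 := by
  have hy : HasDerivAt (fun x => x + W.x₀) 1 p.2 := (hasDerivAt_id p.2).add_const W.x₀
  have hV := W.hasDerivAt_potential_snd p
  have hx := hasDerivAt_dx (hθ.differentiableAt (by simp))
  have hxx := hasDerivAt_dxx hθ
  have htx := hasDerivAt_dx ((contDiffAt_dt hθ).differentiableAt (by simp))
  refine ((((hxx.inner ℝ htx).const_mul 2).add ((((hy.mul hxx.norm_sq).sub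
    ((hy.mul hV).mul hx.norm_sq)).add (hxx.inner ℝ hx)).const_mul
      (W.m / p.1 : ℝ))).const_mul (p.1 ^ (2 * W.m))).congr_deriv ?_
  simp only [Pi.mul_apply, real_inner_self_eq_norm_sq]
  ring

theorem deriv_weightedEnergy_sub_deriv_energyFlux (hp : p.1 ≠ 0) (hθ : ContDiffAt ℝ ∞ θ p) :
    deriv (fun t => W.weightedEnergy θ (t, p.2)) p.1 -
        deriv (fun x => W.energyFlux θ (p.1, x)) p.2 =
      p.1 ^ (2 * W.m) * (2 * ⟪W.potential p • θ p - dxx θ p.1 p.2,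
          W.conjHeat θ p - (W.potential p • θ p - dxx θ p.1 p.2)⟫_ℝ -
        W.dissipation p * ‖θ p‖ ^ 2) := by
  have hG : W.conjHeat θ p - (W.potential p • θ p - dxx θ p.1 p.2) =
      dt θ p.1 p.2 + (W.m * (p.2 + W.x₀) / p.1) • dx θ p.1 p.2 + (W.m / (2 * p.1)) • θ p := by
    rw [conjHeat, heat]
    abel
  rw [(W.hasDerivAt_weightedEnergy_fst hp hθ).deriv, (W.hasDerivAt_energyFlux_snd hθ).deriv, hG,
    ← mul_sub]
  congr 1
  simp only [inner_sub_left, inner_add_right, real_inner_smul_left, real_inner_smul_right,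
    real_inner_self_eq_norm_sq, real_inner_comm (dxx θ p.1 p.2) (dx θ p.1 p.2)]
  simp only [energyDensity, dissipation, potential]
  field_simp
  ring

theorem deriv_weightedEnergy_sub_le (hp : 0 < p.1) (hθ : ContDiffAt ℝ ∞ θ p)
    (hW : 0 ≤ W.dissipation p) :
    deriv (fun t => W.weightedEnergy θ (t, p.2)) p.1 -
        deriv (fun x => W.energyFlux θ (p.1, x)) p.2 ≤
      p.1 ^ (2 * W.m) * (‖W.conjHeat θ p‖ ^ 2 / 2) := by
  rw [W.deriv_weightedEnergy_sub_deriv_energyFlux hp.ne' hθ]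
  gcongr
  exact (sub_le_self _ (by positivity)).trans (two_mul_inner_sub_le _ _)

theorem integral_weightedEnergy_sub_le {L a b : ℝ} (hL : 0 ≤ L) (ha : 0 < a) (hab : a ≤ b)
    (hθ : ∀ p ∈ rect L a b, ContDiffAt ℝ ∞ θ p) (hW : ∀ p ∈ rect L a b, 0 ≤ W.dissipation p) :
    (∫ x in -L..L, W.weightedEnergy θ (b, x)) - (∫ x in -L..L, W.weightedEnergy θ (a, x)) ≤
      (∫ t in a..b, (W.energyFlux θ (t, L) - W.energyFlux θ (t, -L))) +
        ∫ p in rect L a b, p.1 ^ (2 * W.m) * (‖W.conjHeat θ p‖ ^ 2 / 2) := by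
  have hpos : ∀ p ∈ rect L a b, 0 < p.1 := fun p hp => ha.trans_le hp.1.1
  refine integral_sub_integral_le_of_divergence_le hL hab
    (fun p hp => (W.contDiffAt_weightedEnergy (hpos p hp).ne' (hθ p hp)).of_le (by simp))
    (fun p hp => (W.contDiffAt_energyFlux (hpos p hp).ne' (hθ p hp)).of_le (by simp))
    (integrableOn_rect fun p hp => ?_)
    (fun p hp => W.deriv_weightedEnergy_sub_le (hpos p hp) (hθ p hp) (hW p hp))
  have hG := W.continuousAt_conjHeat (hpos p hp).ne' (hθ p hp)
  fun_prop

/-- The flux in the conservation law obtained by multiplying the conjugated equation by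
`2 t θ`. -/
def massFlux (θ : ℝ × ℝ → ℂ) (p : ℝ × ℝ) : ℝ :=
  2 * p.1 * ⟪dx θ p.1 p.2, θ p⟫_ℝ - W.m * ((p.2 + W.x₀) * ‖θ p‖ ^ 2)

theorem deriv_mass_sub_deriv_massFlux (hp : p.1 ≠ 0) (hθ : ContDiffAt ℝ ∞ θ p) :
    deriv (fun t => t * ‖θ (t, p.2)‖ ^ 2) p.1 - deriv (fun x => W.massFlux θ (p.1, x)) p.2 =
      ‖θ p‖ ^ 2 + 2 * p.1 * ⟪θ p, W.conjHeat θ p⟫_ℝ - 2 * p.1 * W.energyDensity θ p := by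
  have hy : HasDerivAt (fun x => x + W.x₀) 1 p.2 := (hasDerivAt_id p.2).add_const W.x₀
  have hx := hasDerivAt_dx (hθ.differentiableAt (by simp))
  have ht := (hasDerivAt_id p.1).mul (hasDerivAt_dt (hθ.differentiableAt (by simp))).norm_sq
  have hflux := (((hasDerivAt_dxx hθ).inner ℝ hx).const_mul (2 * p.1)).sub
    ((hy.mul hx.norm_sq).const_mul (W.m : ℝ))
  refine (congrArg₂ (· - ·) ht.deriv hflux.deriv).trans ?_
  simp only [conjHeat, heat, energyDensity, inner_sub_right, inner_add_right,
    real_inner_smul_right, real_inner_self_eq_norm_sq, id,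
    real_inner_comm (θ p) (dxx θ p.1 p.2)]
  field_simp
  ring

theorem deriv_neg_mass_sub_le (hp : p.1 ≠ 0) (hθ : ContDiffAt ℝ ∞ θ p) :
    deriv (fun t => -(t * ‖θ (t, p.2)‖ ^ 2)) p.1 - deriv (fun x => -W.massFlux θ (p.1, x)) p.2 ≤
      2 * (p.1 ^ 2 * ‖W.conjHeat θ p‖ ^ 2) + 2 * (p.1 * W.energyDensity θ p) -
        ‖θ p‖ ^ 2 / 2 := by
  have hyoung : -(2 * p.1 * ⟪θ p, W.conjHeat θ p⟫_ℝ) ≤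
      2 * (p.1 ^ 2 * ‖W.conjHeat θ p‖ ^ 2) + ‖θ p‖ ^ 2 / 2 := by
    have h := norm_add_sq_real (θ p) ((2 * p.1) • W.conjHeat θ p)
    rw [real_inner_smul_right, norm_smul, mul_pow, Real.norm_eq_abs, sq_abs] at h
    linarith [sq_nonneg ‖θ p + (2 * p.1) • W.conjHeat θ p‖]
  rw [deriv.fun_neg, deriv.fun_neg]
  linarith [W.deriv_mass_sub_deriv_massFlux hp hθ]

theorem integral_norm_sq_le_energy {L a b : ℝ} (hL : 0 ≤ L) (ha : 0 < a) (hab : a ≤ b)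
    (hθ : ∀ p ∈ rect L a b, ContDiffAt ℝ ∞ θ p)
    (hl : ∀ t ∈ Icc a b, θ (t, -L) = 0) (hr : ∀ t ∈ Icc a b, θ (t, L) = 0) :
    ∫ p in rect L a b, ‖θ p‖ ^ 2 / 2 ≤
      b * (∫ x in -L..L, ‖θ (b, x)‖ ^ 2) +
        (2 * (∫ p in rect L a b, p.1 ^ 2 * ‖W.conjHeat θ p‖ ^ 2) +
          2 * ∫ p in rect L a b, p.1 * W.energyDensity θ p) := by
  have hne : ∀ p ∈ rect L a b, p.1 ≠ 0 := fun p hp => (ha.trans_le hp.1.1).ne'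
  have hE : IntegrableOn (fun p => p.1 * W.energyDensity θ p) (rect L a b) :=
    integrableOn_rect fun p hp =>
      continuousAt_fst.mul (W.contDiffAt_energyDensity (hne p hp) (hθ p hp)).continuousAt
  have hG : IntegrableOn (fun p => p.1 ^ 2 * ‖W.conjHeat θ p‖ ^ 2) (rect L a b) :=
    integrableOn_rect fun p hp =>
      (continuousAt_fst.pow 2).mul ((W.continuousAt_conjHeat (hne p hp) (hθ p hp)).norm.pow 2)
  have hm : IntegrableOn (fun p => ‖θ p‖ ^ 2 / 2) (rect L a b) :=
    integrableOn_rect fun p hp => ((hθ p hp).continuousAt.norm.pow 2).div_const 2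
  have hmass : ∀ p ∈ rect L a b, ContDiffAt ℝ 1 (fun p => -(p.1 * ‖θ p‖ ^ 2)) p := fun p hp =>
    (contDiffAt_fst.mul (((hθ p hp).norm_sq ℝ).of_le (by simp))).neg
  have hflux : ∀ p ∈ rect L a b, ContDiffAt ℝ 1 (fun p => -W.massFlux θ p) p := fun p hp => by
    have h_sq := (hθ p hp).norm_sq ℝ
    have hxθ := (contDiffAt_dx (hθ p hp)).inner ℝ (hθ p hp)
    refine ContDiffAt.of_le (n := ∞) ?_ (by simp)
    unfold massFlux
    fun_prop
  have hzero : ∫ t in a..b, (-W.massFlux θ (t, L) - -W.massFlux θ (t, -L)) = 0 := by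
    rw [← intervalIntegral.integral_zero (a := a) (b := b)]
    refine intervalIntegral.integral_congr fun t ht => ?_
    rw [uIcc_of_le hab] at ht
    simp [massFlux, hl t ht, hr t ht]
  have key := integral_sub_integral_le_of_divergence_le hL hab hmass hflux
    (((hG.const_mul 2).add (hE.const_mul 2)).sub hm)
    (fun p hp => W.deriv_neg_mass_sub_le (hne p hp) (hθ p hp))
  simp only [Pi.sub_apply, Pi.add_apply] at key
  rw [hzero, zero_add, integral_sub ((hG.const_mul 2).fun_add (hE.const_mul 2)) hm,
    integral_add (hG.const_mul 2) (hE.const_mul 2), integral_const_mul, integral_const_mul] at key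
  simp only [intervalIntegral.integral_neg, intervalIntegral.integral_const_mul] at key
  have hinit : 0 ≤ a * ∫ x in -L..L, ‖θ (a, x)‖ ^ 2 :=
    mul_nonneg ha.le (intervalIntegral.integral_nonneg (neg_le_self hL) fun x _ => by positivity)
  linarith

end Carleman

end Energy

section Observation

variable {L T : ℝ} {ψ : ℝ × ℝ → ℂ}

theorem continuous_dx (hψ : ContDiff ℝ ∞ ψ) : Continuous fun p : ℝ × ℝ => dx ψ p.1 p.2 :=
  continuous_iff_continuousAt.2 fun _ => (contDiffAt_dx hψ.contDiffAt).continuousAt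

theorem continuous_heat (hψ : ContDiff ℝ ∞ ψ) : Continuous (heat ψ) :=
  continuous_iff_continuousAt.2 fun _ =>
    (contDiffAt_dt hψ.contDiffAt).continuousAt.sub (contDiffAt_dxx hψ.contDiffAt).continuousAt

theorem IsTest.mono {s : ℝ} (hψ : IsTest L T ψ) (hs : s ≤ T) : IsTest L s ψ :=
  ⟨hψ.smooth, fun t ht => hψ.left t ⟨ht.1, ht.2.trans hs⟩,
    fun t ht => hψ.right t ⟨ht.1, ht.2.trans hs⟩⟩

theorem dt_eq_zero_of_forall_eq_zero {x : ℝ} (hψ : ContDiff ℝ ∞ ψ)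
    (h : ∀ t ∈ Icc 0 T, ψ (t, x) = 0) {t : ℝ} (ht : t ∈ Ioc 0 T) : dt ψ t x = 0 := by
  have ht' : t ∈ Icc 0 T := Ioc_subset_Icc_self ht
  have hderiv := hasDerivAt_dt (hψ.differentiable (by simp) (t, x))
  exact (uniqueDiffOn_Icc (ht.1.trans_le ht.2) t ht').eq_deriv _ hderiv.hasDerivWithinAt
    ((hasDerivWithinAt_const t (Icc 0 T) (0 : ℂ)).congr h (h t ht'))

/-- The squared size of what is observed of `ψ` up to time `T`: its normal derivatives on the
lateral boundary and its image under the heat operator. -/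
def observation (L T : ℝ) (ψ : ℝ × ℝ → ℂ) : ℝ :=
  (∫ t in 0..T, (‖dx ψ t (-L)‖ ^ 2 + ‖dx ψ t L‖ ^ 2)) + ∫ p in rect L 0 T, ‖heat ψ p‖ ^ 2

theorem integral_boundary_nonneg (hT : 0 ≤ T) :
    0 ≤ ∫ t in 0..T, (‖dx ψ t (-L)‖ ^ 2 + ‖dx ψ t L‖ ^ 2) :=
  intervalIntegral.integral_nonneg hT fun _ _ => by positivity

theorem integral_boundary_mono (hψ : ContDiff ℝ ∞ ψ) {a b : ℝ} (ha : 0 ≤ a) (hab : a ≤ b)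
    (hb : b ≤ T) :
    ∫ t in a..b, (‖dx ψ t (-L)‖ ^ 2 + ‖dx ψ t L‖ ^ 2) ≤
      ∫ t in 0..T, (‖dx ψ t (-L)‖ ^ 2 + ‖dx ψ t L‖ ^ 2) := by
  have hx := continuous_dx hψ
  have hl : Continuous fun t => dx ψ t (-L) := hx.comp (by fun_prop : Continuous fun t => (t, -L))
  have hr : Continuous fun t => dx ψ t L := hx.comp (by fun_prop : Continuous fun t => (t, L))
  exact intervalIntegral.integral_mono_interval ha hab hb
    (.of_forall fun t => by simp only [Pi.zero_apply]; positivity)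
    (Continuous.intervalIntegrable (by fun_prop) _ _)

theorem integral_rect_mono {f : ℝ × ℝ → ℝ} (hf : IntegrableOn f (rect L 0 T)) (h0 : 0 ≤ f)
    {a b : ℝ} (ha : 0 ≤ a) (hb : b ≤ T) : ∫ p in rect L a b, f p ≤ ∫ p in rect L 0 T, f p :=
  setIntegral_mono_set hf (.of_forall h0)
    (prod_mono (Icc_subset_Icc ha hb) subset_rfl).eventuallyLE

theorem integrableOn_norm_sq_rect {f : ℝ × ℝ → ℂ} (hf : Continuous f) (a b : ℝ) :
    IntegrableOn (fun p => ‖f p‖ ^ 2) (rect L a b) :=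
  integrableOn_rect fun _ _ => (hf.norm.pow 2).continuousAt

theorem integral_heat_le_observation (hT : 0 ≤ T) :
    ∫ p in rect L 0 T, ‖heat ψ p‖ ^ 2 ≤ observation L T ψ :=
  le_add_of_nonneg_left (integral_boundary_nonneg hT)

theorem observation_nonneg (hT : 0 ≤ T) : 0 ≤ observation L T ψ :=
  (integral_nonneg fun _ => by positivity).trans (integral_heat_le_observation hT)

theorem observation_mono (hψ : ContDiff ℝ ∞ ψ) {s : ℝ} (hs : 0 ≤ s) (hsT : s ≤ T) :
    observation L s ψ ≤ observation L T ψ :=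
  add_le_add (integral_boundary_mono hψ le_rfl hs hsT)
    (integral_rect_mono (integrableOn_norm_sq_rect (continuous_heat hψ) 0 T)
      (fun _ => by positivity) le_rfl hsT)

end Observation

namespace Carleman

/-- The conditions under which a Carleman weight controls the solutions on `(0, T) × (-L, L)`:
its phase is nonnegative there and the weighted energy is dissipated. -/
structure Admissible (W : Carleman) (L T : ℝ) : Prop where
  one_le_m : 1 ≤ W.m
  c_nonneg : 0 ≤ W.c
  add_abs_le : L + |W.x₀| ≤ W.R
  dissipation_nonneg : ∀ p ∈ Ioc 0 T ×ˢ Icc (-L) L, 0 ≤ W.dissipation p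

namespace Admissible

variable {W : Carleman} {L T : ℝ}

theorem abs_add_x₀_le (hW : W.Admissible L T) {x : ℝ} (hx : x ∈ Icc (-L) L) : |x + W.x₀| ≤ W.R :=
  (abs_add_le x W.x₀).trans ((add_le_add_left (abs_le.2 hx) _).trans hW.add_abs_le)

theorem abs_add_x₀_lt (hW : W.Admissible L T) {x : ℝ} (hx : x ∈ Ioo (-L) L) : |x + W.x₀| < W.R :=
  (abs_add_le x W.x₀).trans_lt
    ((add_lt_add_left (abs_lt.2 hx) _).trans_le hW.add_abs_le)

theorem le_phase (hW : W.Admissible L T) {p : ℝ × ℝ} (hp : 0 ≤ p.1) :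
    W.m * (W.R ^ 2 - (p.2 + W.x₀) ^ 2) / (4 * p.1) ≤ W.phase p :=
  le_add_of_nonneg_right (mul_nonneg hW.c_nonneg hp)

theorem weight_le_one (hW : W.Admissible L T) {p : ℝ × ℝ} (hp : 0 ≤ p.1)
    (hx : p.2 ∈ Icc (-L) L) : W.weight p ≤ 1 := by
  have hy : 0 ≤ W.R ^ 2 - (p.2 + W.x₀) ^ 2 := sub_nonneg.2 (sq_le_sq' (abs_le.1
    (hW.abs_add_x₀_le hx)).1 (abs_le.1 (hW.abs_add_x₀_le hx)).2)
  have hphase : 0 ≤ W.phase p := le_trans (by positivity) (hW.le_phase hp)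
  exact Real.exp_le_one_iff.2 (neg_nonpos.2 hphase)

theorem norm_weight_smul_le (hW : W.Admissible L T) {p : ℝ × ℝ} (hp : 0 ≤ p.1)
    (hx : p.2 ∈ Icc (-L) L) (z : ℂ) : ‖W.weight p • z‖ ≤ ‖z‖ := by
  rw [norm_smul, Real.norm_of_nonneg (W.weight_pos p).le]
  exact mul_le_of_le_one_left (norm_nonneg z) (hW.weight_le_one hp hx)

theorem tendsto_weight_sq (hW : W.Admissible L T) {x : ℝ} (hx : x ∈ Ioo (-L) L) :
    Tendsto (fun t => W.weight (t, x) ^ 2) (𝓝[>] 0) (𝓝 0) := by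
  have hy : 0 < W.R ^ 2 - (x + W.x₀) ^ 2 :=
    sub_pos.2 (sq_lt_sq' (abs_lt.1 (hW.abs_add_x₀_lt hx)).1 (abs_lt.1 (hW.abs_add_x₀_lt hx)).2)
  have hm : (0 : ℝ) < W.m := by exact_mod_cast hW.one_le_m
  have hlim : Tendsto (fun t : ℝ => -(W.m * (W.R ^ 2 - (x + W.x₀) ^ 2) / 2 * t⁻¹))
      (𝓝[>] 0) atBot :=
    tendsto_neg_atTop_atBot.comp
      (Tendsto.const_mul_atTop (by positivity) tendsto_inv_nhdsGT_zero)
  refine squeeze_zero' (.of_forall fun _ => sq_nonneg _) ?_ (Real.tendsto_exp_atBot.comp hlim)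
  filter_upwards [self_mem_nhdsWithin] with t ht
  rw [weight_sq, Function.comp_apply, Real.exp_le_exp]
  have hphase := hW.le_phase (p := (t, x)) (le_of_lt ht)
  have : W.m * (W.R ^ 2 - (x + W.x₀) ^ 2) / (4 * t) =
      W.m * (W.R ^ 2 - (x + W.x₀) ^ 2) / 2 * t⁻¹ / 2 := by field_simp; norm_num
  linarith

end Admissible

variable (W : Carleman) {L T : ℝ} {ψ : ℝ × ℝ → ℂ} {p : ℝ × ℝ}

/-- The weighted energy of `exp (-φ) ψ` without its factor `exp (-2 φ)`, in a form that is
continuous up to `t = 0`. -/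
def unweightedEnergy (ψ : ℝ × ℝ → ℂ) (p : ℝ × ℝ) : ℝ :=
  p.1 ^ (2 * (W.m - 1)) * (‖p.1 • dx ψ p.1 p.2 + (W.m * (p.2 + W.x₀) / 2) • ψ p‖ ^ 2 +
    (W.c * p.1 ^ 2 - (W.m * W.R ^ 2 + (W.m ^ 2 - W.m) * (p.2 + W.x₀) ^ 2) / 4) * ‖ψ p‖ ^ 2)

theorem continuous_unweightedEnergy (hψ : ContDiff ℝ ∞ ψ) :
    Continuous (W.unweightedEnergy ψ) := by
  have hx := continuous_dx hψ
  have h := hψ.continuous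
  unfold unweightedEnergy
  fun_prop

theorem weightedEnergy_conj (hm : 1 ≤ W.m) (hp : 0 < p.1) (hψ : DifferentiableAt ℝ ψ p) :
    W.weightedEnergy (W.conj ψ) p = W.weight p ^ 2 * W.unweightedEnergy ψ p := by
  have hpow : p.1 ^ (2 * W.m) = p.1 ^ (2 * (W.m - 1)) * p.1 ^ 2 := by
    rw [← pow_add]
    congr 1
    omega
  have hx : dx ψ p.1 p.2 + (W.m * (p.2 + W.x₀) / (2 * p.1)) • ψ p =
      p.1⁻¹ • (p.1 • dx ψ p.1 p.2 + (W.m * (p.2 + W.x₀) / 2) • ψ p) := by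
    match_scalars <;> field_simp
  rw [weightedEnergy, energyDensity, W.dx_conj hψ, hx, conj, unweightedEnergy, hpow, potential]
  simp only [norm_smul, mul_pow, Real.norm_eq_abs, sq_abs]
  field_simp

theorem Admissible.tendsto_integral_weightedEnergy {W : Carleman} (hW : W.Admissible L T)
    (hL : 0 ≤ L) (hψ : ContDiff ℝ ∞ ψ) :
    Tendsto (fun t => ∫ x in -L..L, W.weightedEnergy (W.conj ψ) (t, x))
      (𝓝[>] 0) (𝓝 0) := by
  have hcont := W.continuous_unweightedEnergy hψ
  obtain ⟨B, hB⟩ := (isCompact_rect L 0 1).exists_bound_of_continuousOn hcont.continuousOn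
  have hmem : ∀ᶠ t in 𝓝[>] (0 : ℝ), t ∈ Ioc (0 : ℝ) 1 := Ioc_mem_nhdsGT one_pos
  have hlim : Tendsto
      (fun t => ∫ x in -L..L, W.weight (t, x) ^ 2 * W.unweightedEnergy ψ (t, x))
      (𝓝[>] 0) (𝓝 (∫ _ in -L..L, (0 : ℝ))) := by
    refine intervalIntegral.tendsto_integral_filter_of_dominated_convergence (fun _ => B)
      (.of_forall fun _ => Continuous.aestronglyMeasurable ?_) ?_ intervalIntegrable_const ?_
    · simp only [weight, phase]
      fun_prop
    · filter_upwards [hmem] with t ht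
      refine .of_forall fun x hx => ?_
      rw [uIoc_of_le (neg_le_self hL)] at hx
      have hx' := Ioc_subset_Icc_self hx
      rw [norm_mul, Real.norm_of_nonneg (sq_nonneg _)]
      have hweight := pow_le_one₀ (n := 2) (W.weight_pos (t, x)).le
        (hW.weight_le_one (p := (t, x)) ht.1.le hx')
      exact (mul_le_of_le_one_left (norm_nonneg _) hweight).trans
        (hB _ ⟨⟨ht.1.le, ht.2⟩, hx'⟩)
    · filter_upwards [Measure.ae_ne volume L] with x hxL hx
      rw [uIoc_of_le (neg_le_self hL)] at hx
      have hq : Tendsto (fun t => W.unweightedEnergy ψ (t, x)) (𝓝[>] 0)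
          (𝓝 (W.unweightedEnergy ψ (0, x))) :=
        ((by fun_prop : Continuous fun t => W.unweightedEnergy ψ (t, x)).tendsto 0).mono_left
          nhdsWithin_le_nhds
      simpa only [zero_mul] using (hW.tendsto_weight_sq ⟨hx.1, hx.2.lt_of_ne hxL⟩).mul hq
  rw [intervalIntegral.integral_zero] at hlim
  refine hlim.congr' ?_
  filter_upwards [hmem] with t ht
  exact intervalIntegral.integral_congr fun x _ =>
    (W.weightedEnergy_conj hW.one_le_m ht.1 (hψ.differentiable (by simp) (t, x))).symm

theorem energyFlux_conj_of_eq_zero (hp : p.1 ≠ 0) (hψ : DifferentiableAt ℝ ψ p) (h0 : ψ p = 0)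
    (ht : dt ψ p.1 p.2 = 0) :
    W.energyFlux (W.conj ψ) p =
      p.1 ^ (2 * W.m) / p.1 * (W.m * (p.2 + W.x₀) * ‖W.weight p • dx ψ p.1 p.2‖ ^ 2) := by
  rw [energyFlux, W.dt_conj hp hψ, W.dx_conj hψ, conj, h0, ht]
  simp only [smul_zero, add_zero, inner_zero_right, norm_zero]
  ring

namespace Admissible

variable {W : Carleman}

theorem abs_energyFlux_conj_le (hW : W.Admissible L T) (hp : p ∈ Ioc 0 T ×ˢ Icc (-L) L)
    (hψ : DifferentiableAt ℝ ψ p) (h0 : ψ p = 0) (ht : dt ψ p.1 p.2 = 0) :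
    |W.energyFlux (W.conj ψ) p| ≤
      T ^ (2 * W.m) / T * (W.m * W.R * ‖dx ψ p.1 p.2‖ ^ 2) := by
  have hp0 : 0 < p.1 := hp.1.1
  have hT : 0 < T := hp0.trans_le hp.1.2
  have hpow : p.1 ^ (2 * W.m) / p.1 ≤ T ^ (2 * W.m) / T := by
    have hm : 2 * W.m ≠ 0 := by have := hW.one_le_m; omega
    rw [← pow_sub_one_mul hm, ← pow_sub_one_mul hm, mul_div_cancel_right₀ _ hp0.ne',
      mul_div_cancel_right₀ _ hT.ne']
    exact pow_le_pow_left₀ hp0.le hp.1.2 _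
  have hR : 0 ≤ W.R := (abs_nonneg _).trans (hW.abs_add_x₀_le hp.2)
  rw [W.energyFlux_conj_of_eq_zero hp0.ne' hψ h0 ht, abs_mul, abs_mul, abs_mul,
    abs_of_nonneg (by positivity : 0 ≤ p.1 ^ (2 * W.m) / p.1), Nat.abs_cast, abs_sq]
  gcongr
  exacts [hW.abs_add_x₀_le hp.2, hW.norm_weight_smul_le hp0.le hp.2 _]

theorem integral_energyFlux_conj_le (hW : W.Admissible L T) (hL : 0 ≤ L) (hψ : IsTest L T ψ)
    {a : ℝ} (ha : 0 < a) (haT : a ≤ T) :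
    ∫ t in a..T, (W.energyFlux (W.conj ψ) (t, L) - W.energyFlux (W.conj ψ) (t, -L)) ≤
      T ^ (2 * W.m) / T *
        (W.m * W.R * ∫ t in 0..T, (‖dx ψ t (-L)‖ ^ 2 + ‖dx ψ t L‖ ^ 2)) := by
  have hT : 0 < T := ha.trans_le haT
  have hR : 0 ≤ W.R := (abs_nonneg _).trans (hW.abs_add_x₀_le ⟨neg_le_self hL, le_refl L⟩)
  have hx := continuous_dx hψ.smooth
  have hxl : Continuous fun t => dx ψ t (-L) := hx.comp (by fun_prop : Continuous fun t => (t, -L))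
  have hxr : Continuous fun t => dx ψ t L := hx.comp (by fun_prop : Continuous fun t => (t, L))
  have hflux (x : ℝ) :
      IntervalIntegrable (fun t => W.energyFlux (W.conj ψ) (t, x)) volume a T := by
    refine ContinuousOn.intervalIntegrable fun t ht => ContinuousAt.continuousWithinAt ?_
    rw [uIcc_of_le haT] at ht
    have ht0 : t ≠ 0 := (ha.trans_le ht.1).ne'
    exact (W.contDiffAt_energyFlux (p := (t, x)) ht0
      (W.contDiffAt_conj ht0 hψ.smooth.contDiffAt)).continuousAt.comp (f := fun t => (t, x))
        (by fun_prop)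
  have hbound {x : ℝ} (hx : x ∈ Icc (-L) L) (h0 : ∀ t ∈ Icc 0 T, ψ (t, x) = 0) {t : ℝ}
      (ht : t ∈ Icc a T) : |W.energyFlux (W.conj ψ) (t, x)| ≤
        T ^ (2 * W.m) / T * (W.m * W.R * ‖dx ψ t x‖ ^ 2) := by
    have ht' : t ∈ Ioc 0 T := ⟨ha.trans_le ht.1, ht.2⟩
    exact hW.abs_energyFlux_conj_le (p := (t, x)) ⟨ht', hx⟩
      (hψ.smooth.differentiable (by simp) _) (h0 t (Ioc_subset_Icc_self ht'))
      (dt_eq_zero_of_forall_eq_zero hψ.smooth h0 ht')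
  calc _ ≤ ∫ t in a..T, T ^ (2 * W.m) / T *
        (W.m * W.R * (‖dx ψ t (-L)‖ ^ 2 + ‖dx ψ t L‖ ^ 2)) := by
        refine intervalIntegral.integral_mono_on haT ((hflux L).sub (hflux (-L)))
          (Continuous.intervalIntegrable (by fun_prop) _ _) fun t ht => ?_
        have hl := neg_abs_le (W.energyFlux (W.conj ψ) (t, -L))
        have hr := le_abs_self (W.energyFlux (W.conj ψ) (t, L))
        linarith [hbound ⟨le_rfl, neg_le_self hL⟩ hψ.left ht,
          hbound ⟨neg_le_self hL, le_rfl⟩ hψ.right ht]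
    _ = T ^ (2 * W.m) / T *
        (W.m * W.R * ∫ t in a..T, (‖dx ψ t (-L)‖ ^ 2 + ‖dx ψ t L‖ ^ 2)) := by
        rw [intervalIntegral.integral_const_mul, intervalIntegral.integral_const_mul]
    _ ≤ _ := by
        gcongr
        exact integral_boundary_mono hψ.smooth ha.le haT le_rfl

theorem integral_pow_mul_conjHeat_conj_le (hW : W.Admissible L T) (hψ : ContDiff ℝ ∞ ψ) (k : ℕ)
    {a : ℝ} (ha : 0 < a) (haT : a ≤ T) :
    ∫ p in rect L a T, p.1 ^ k * ‖W.conjHeat (W.conj ψ) p‖ ^ 2 ≤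
      T ^ k * ∫ p in rect L 0 T, ‖heat ψ p‖ ^ 2 := by
  have hT : 0 < T := ha.trans_le haT
  have hpos : ∀ p ∈ rect L a T, 0 < p.1 := fun p hp => ha.trans_le hp.1.1
  have hheat := integrableOn_norm_sq_rect (L := L) (continuous_heat hψ)
  have hconj : IntegrableOn (fun p => p.1 ^ k * ‖W.conjHeat (W.conj ψ) p‖ ^ 2) (rect L a T) :=
    integrableOn_rect fun p hp => (continuousAt_fst.pow k).mul ((W.continuousAt_conjHeat
      (hpos p hp).ne' (W.contDiffAt_conj (hpos p hp).ne' hψ.contDiffAt)).norm.pow 2)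
  calc _ ≤ ∫ p in rect L a T, T ^ k * ‖heat ψ p‖ ^ 2 := by
        refine setIntegral_mono_on hconj ((hheat a T).const_mul _)
          (isCompact_rect L a T).measurableSet fun p hp => ?_
        have hp0 := hpos p hp
        rw [W.conjHeat_conj hp0.ne' hψ]
        gcongr
        exacts [hp.1.2, hW.norm_weight_smul_le hp0.le hp.2 _]
    _ = T ^ k * ∫ p in rect L a T, ‖heat ψ p‖ ^ 2 := integral_const_mul _ _
    _ ≤ _ := by
        refine mul_le_mul_of_nonneg_left ?_ (by positivity)
        exact integral_rect_mono (hheat 0 T) (fun _ => sq_nonneg _) ha.le le_rfl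

theorem integral_weightedEnergy_le_add (hW : W.Admissible L T) (hL : 0 ≤ L) (hψ : IsTest L T ψ)
    {a : ℝ} (ha : 0 < a) (haT : a ≤ T) :
    ∫ x in -L..L, W.weightedEnergy (W.conj ψ) (T, x) ≤
      T ^ (2 * W.m) / T * ((W.m * W.R + T / 2) * observation L T ψ) +
        ∫ x in -L..L, W.weightedEnergy (W.conj ψ) (a, x) := by
  have hT : 0 < T := ha.trans_le haT
  have hR : 0 ≤ W.R := (abs_nonneg _).trans (hW.abs_add_x₀_le ⟨neg_le_self hL, le_refl L⟩)
  have henergy := W.integral_weightedEnergy_sub_le (θ := W.conj ψ) hL ha haT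
    (fun p hp => W.contDiffAt_conj (ha.trans_le hp.1.1).ne' hψ.smooth.contDiffAt)
    (fun p hp => hW.dissipation_nonneg p ⟨⟨ha.trans_le hp.1.1, hp.1.2⟩, hp.2⟩)
  simp only [← mul_div_assoc, integral_div] at henergy
  have hflux := hW.integral_energyFlux_conj_le hL hψ ha haT
  have hsource := hW.integral_pow_mul_conjHeat_conj_le hψ.smooth (2 * W.m) ha haT
  have hobs : W.m * W.R * (∫ t in 0..T, (‖dx ψ t (-L)‖ ^ 2 + ‖dx ψ t L‖ ^ 2)) +
      T / 2 * ∫ p in rect L 0 T, ‖heat ψ p‖ ^ 2 ≤ (W.m * W.R + T / 2) * observation L T ψ := by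
    have hbdry := integral_boundary_nonneg (L := L) (ψ := ψ) hT.le
    have hint : 0 ≤ ∫ p in rect L 0 T, ‖heat ψ p‖ ^ 2 := integral_nonneg fun _ => by positivity
    rw [observation, add_mul]
    gcongr <;> linarith
  have hfactor := mul_le_mul_of_nonneg_left hobs (by positivity : 0 ≤ T ^ (2 * W.m) / T)
  have hcancel : T ^ (2 * W.m) / T * (T / 2 * ∫ p in rect L 0 T, ‖heat ψ p‖ ^ 2) =
      (T ^ (2 * W.m) * ∫ p in rect L 0 T, ‖heat ψ p‖ ^ 2) / 2 := by field_simp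
  linarith

theorem energy_le_observation (hW : W.Admissible L T) (hL : 0 ≤ L) (hT : 0 < T)
    (hψ : IsTest L T ψ) :
    T * ∫ x in -L..L, W.energyDensity (W.conj ψ) (T, x) ≤
      (W.m * W.R + T / 2) * observation L T ψ := by
  have hlim := (hW.tendsto_integral_weightedEnergy hL hψ.smooth).const_add
    (T ^ (2 * W.m) / T * ((W.m * W.R + T / 2) * observation L T ψ))
  have hle := ge_of_tendsto hlim (eventually_of_mem (Ioc_mem_nhdsGT hT) fun a ha =>
    hW.integral_weightedEnergy_le_add hL hψ ha.1 ha.2)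
  simp only [weightedEnergy, intervalIntegral.integral_const_mul, add_zero] at hle
  refine le_of_mul_le_mul_left (hle.trans_eq' ?_) (by positivity : 0 < T ^ (2 * W.m) / T)
  field_simp

end Admissible

end Carleman

section FinalTime

open Carleman

variable {L T : ℝ}

/-- The Carleman weight for the observability of the final state. Its centre `-9 L` lies outside
the interval, so that the self-similar part of the dissipation dominates the negative contribution
of the rate `c`, itself chosen so that the potential is positive at time `T`. -/
def finalTimeWeight (L T : ℝ) : Carleman := ⟨4, 10 * L, 401 * L ^ 2 / T ^ 2, 9 * L⟩

theorem admissible_finalTimeWeight (hL : 0 ≤ L) : (finalTimeWeight L T).Admissible L T where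
  one_le_m := by simp [finalTimeWeight]
  c_nonneg := by simp only [finalTimeWeight]; positivity
  add_abs_le := by
    simp only [finalTimeWeight, abs_of_nonneg (by positivity : 0 ≤ 9 * L)]
    linarith
  dissipation_nonneg p hp := by
    have ht : 0 < p.1 := hp.1.1
    have hT : 0 < T := ht.trans_le hp.1.2
    have hsq : p.1 ^ 2 ≤ T ^ 2 := pow_le_pow_left₀ ht.le hp.1.2 2
    have hy : 64 * L ^ 2 ≤ (p.2 + 9 * L) ^ 2 := by nlinarith [hp.2.1]
    have heq : (finalTimeWeight L T).dissipation p =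
        (6 * (100 * L ^ 2 + 7 * (p.2 + 9 * L) ^ 2) * T ^ 2 - 3208 * L ^ 2 * p.1 ^ 2) /
          (p.1 ^ 3 * T ^ 2) := by
      simp only [dissipation, finalTimeWeight, Nat.cast_ofNat]
      field_simp
      ring
    rw [heq]
    refine div_nonneg (sub_nonneg.2 ?_) (by positivity)
    calc 3208 * L ^ 2 * p.1 ^ 2 ≤ 3208 * L ^ 2 * T ^ 2 := by gcongr
      _ ≤ _ := mul_le_mul_of_nonneg_right (by linarith [sq_nonneg L]) (sq_nonneg T)

theorem le_potential_finalTimeWeight (hL : 0 ≤ L) {x : ℝ} (hx : x ∈ Icc (-L) L) :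
    L ^ 2 / T ^ 2 ≤ (finalTimeWeight L T).potential (T, x) := by
  have hy : (x + 9 * L) ^ 2 ≤ 100 * L ^ 2 := by nlinarith [hx.1, hx.2]
  have heq : (finalTimeWeight L T).potential (T, x) =
      L ^ 2 / T ^ 2 + 3 * (100 * L ^ 2 - (x + 9 * L) ^ 2) / T ^ 2 := by
    simp only [potential, finalTimeWeight, Nat.cast_ofNat]
    ring
  rw [heq]
  exact le_add_of_nonneg_right (div_nonneg (by linarith) (sq_nonneg T))

theorem finalTimeWeight_phase_le (hT : 0 < T) (x : ℝ) :
    (finalTimeWeight L T).phase (T, x) ≤ 501 * L ^ 2 / T := by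
  have heq : (finalTimeWeight L T).phase (T, x) = 501 * L ^ 2 / T - (x + 9 * L) ^ 2 / T := by
    simp only [phase, finalTimeWeight, Nat.cast_ofNat]
    field_simp
    ring
  rw [heq]
  exact sub_le_self _ (by positivity)

theorem mul_norm_sq_le_energyDensity_finalTimeWeight (hL : 0 ≤ L) (hT : 0 < T) {x : ℝ}
    (hx : x ∈ Icc (-L) L) (ψ : ℝ × ℝ → ℂ) :
    L ^ 2 / T ^ 2 * Real.exp (-(2 * (501 * L ^ 2 / T))) * ‖ψ (T, x)‖ ^ 2 ≤
      (finalTimeWeight L T).energyDensity ((finalTimeWeight L T).conj ψ) (T, x) := by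
  set W := finalTimeWeight L T
  have hpot := le_potential_finalTimeWeight (T := T) hL hx
  have hweight : Real.exp (-(2 * (501 * L ^ 2 / T))) ≤ W.weight (T, x) ^ 2 := by
    rw [W.weight_sq, Real.exp_le_exp]
    linarith [finalTimeWeight_phase_le (L := L) hT x]
  calc _ ≤ W.potential (T, x) * W.weight (T, x) ^ 2 * ‖ψ (T, x)‖ ^ 2 := by
        gcongr
        exact (by positivity : 0 ≤ L ^ 2 / T ^ 2).trans hpot
    _ = W.potential (T, x) * ‖W.conj ψ (T, x)‖ ^ 2 := by
        rw [conj, norm_smul, mul_pow, Real.norm_eq_abs, sq_abs, mul_assoc]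
    _ ≤ _ := le_add_of_nonneg_left (sq_nonneg _)

theorem exists_integral_final_le_observation (hL : 0 < L) (hT : 0 < T) :
    ∃ C, 0 ≤ C ∧ ∀ ψ, IsTest L T ψ →
      ∫ x in -L..L, ‖ψ (T, x)‖ ^ 2 ≤ C * observation L T ψ := by
  set W := finalTimeWeight L T
  set κ := L ^ 2 / T ^ 2 * Real.exp (-(2 * (501 * L ^ 2 / T)))
  have hR : 0 ≤ W.R := by simp only [W, finalTimeWeight]; positivity
  refine ⟨(W.m * W.R + T / 2) / (T * κ), by positivity, fun ψ hψ => ?_⟩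
  have hcont := hψ.smooth.continuous
  have hψT : Continuous fun x => ‖ψ (T, x)‖ ^ 2 := by fun_prop
  have henergy : ContinuousOn (fun x => W.energyDensity (W.conj ψ) (T, x)) (uIcc (-L) L) :=
    fun x _ => ContinuousAt.continuousWithinAt <| (W.contDiffAt_energyDensity (p := (T, x)) hT.ne'
      (W.contDiffAt_conj hT.ne' hψ.smooth.contDiffAt)).continuousAt.comp (f := fun x => (T, x))
        (by fun_prop)
  have hle : κ * ∫ x in -L..L, ‖ψ (T, x)‖ ^ 2 ≤
      ∫ x in -L..L, W.energyDensity (W.conj ψ) (T, x) := by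
    rw [← intervalIntegral.integral_const_mul]
    exact intervalIntegral.integral_mono_on (neg_le_self hL.le)
      ((hψT.intervalIntegrable _ _).const_mul κ) henergy.intervalIntegrable
      fun x hx => mul_norm_sq_le_energyDensity_finalTimeWeight hL.le hT hx ψ
  rw [div_mul_eq_mul_div, le_div_iff₀ (by positivity)]
  calc _ = T * (κ * ∫ x in -L..L, ‖ψ (T, x)‖ ^ 2) := by ring
    _ ≤ T * ∫ x in -L..L, W.energyDensity (W.conj ψ) (T, x) := by gcongr
    _ ≤ _ := (admissible_finalTimeWeight hL.le).energy_le_observation hL.le hT hψ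

end FinalTime

section Rect

variable {L : ℝ} {f : ℝ × ℝ → ℝ} {a b M : ℝ}

theorem integral_rect_eq (hL : 0 ≤ L) (hab : a ≤ b) (hf : IntegrableOn f (rect L a b)) :
    ∫ p in rect L a b, f p = ∫ t in a..b, ∫ x in -L..L, f (t, x) := by
  simp only [intervalIntegral.integral_of_le hab, intervalIntegral.integral_of_le (neg_le_self hL),
    ← integral_Icc_eq_integral_Ioc]
  exact setIntegral_prod f hf

theorem integrableOn_integral_of_integrableOn_rect (hL : 0 ≤ L) (hf : IntegrableOn f (rect L a b)) :
    IntegrableOn (fun t => ∫ x in -L..L, f (t, x)) (Icc a b) := by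
  simp only [intervalIntegral.integral_of_le (neg_le_self hL), ← integral_Icc_eq_integral_Ioc]
  rw [IntegrableOn, Measure.volume_eq_prod, ← Measure.prod_restrict] at hf
  exact hf.integral_prod_left

theorem integral_rect_le_mul (hL : 0 ≤ L) (hab : a ≤ b) (hf : IntegrableOn f (rect L a b))
    (hle : ∀ t ∈ Icc a b, ∫ x in -L..L, f (t, x) ≤ M) :
    ∫ p in rect L a b, f p ≤ (b - a) * M := by
  rw [integral_rect_eq hL hab hf]
  refine (intervalIntegral.integral_mono_on hab
    ((intervalIntegrable_iff_integrableOn_Icc_of_le hab).2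
      (integrableOn_integral_of_integrableOn_rect hL hf)) intervalIntegrable_const hle).trans_eq ?_
  rw [intervalIntegral.integral_const, smul_eq_mul]

theorem integral_rect_le_of_forall_lt (hL : 0 ≤ L) (hab : a < b) (hf : IntegrableOn f (rect L a b))
    (hle : ∀ s ∈ Ioc a b, ∫ p in rect L s b, f p ≤ M) : ∫ p in rect L a b, f p ≤ M := by
  have hcont : ContinuousOn (fun s => ∫ t in s..b, ∫ x in -L..L, f (t, x)) (Icc a b) := by
    rw [← uIcc_of_le hab.le]
    refine intervalIntegral.continuousOn_primitive_interval_left ?_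
    rw [uIcc_of_le hab.le]
    exact integrableOn_integral_of_integrableOn_rect hL hf
  have hlim : Tendsto (fun s => ∫ t in s..b, ∫ x in -L..L, f (t, x)) (𝓝[>] a)
      (𝓝 (∫ t in a..b, ∫ x in -L..L, f (t, x))) :=
    (hcont a (left_mem_Icc.2 hab.le)).mono_left (nhdsWithin_le_of_mem (Icc_mem_nhdsGT hab))
  rw [integral_rect_eq hL hab.le hf]
  refine le_of_tendsto hlim (eventually_of_mem (Ioc_mem_nhdsGT hab) fun s hs => ?_)
  rw [← integral_rect_eq hL hs.2
    (hf.mono_set (prod_mono (Icc_subset_Icc_left hs.1.le) subset_rfl))]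
  exact hle s hs

end Rect

section Gaussian

open Carleman

variable {L T : ℝ} {ψ : ℝ × ℝ → ℂ} {p : ℝ × ℝ}

/-- The centred Carleman weight `exp (-(L² - x²) / (4 t))`. -/
def gaussianWeight (L : ℝ) : Carleman := ⟨1, L, 0, 0⟩

theorem admissible_gaussianWeight (L T : ℝ) : (gaussianWeight L).Admissible L T where
  one_le_m := le_rfl
  c_nonneg := le_rfl
  add_abs_le := by simp [gaussianWeight]
  dissipation_nonneg p _ := by simp [gaussianWeight, dissipation]

theorem gaussianWeight_weight_sq (L : ℝ) (p : ℝ × ℝ) :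
    (gaussianWeight L).weight p ^ 2 = Real.exp (-((L ^ 2 - p.2 ^ 2) / (2 * p.1))) := by
  rw [weight_sq]
  simp only [phase, gaussianWeight, Nat.cast_one, add_zero, zero_mul, one_mul]
  ring_nf

theorem gaussianWeight_energy_le_observation (hL : 0 ≤ L) (hψ : IsTest L T ψ) {t : ℝ}
    (ht : t ∈ Ioc 0 T) :
    ∫ x in -L..L, t * (gaussianWeight L).energyDensity ((gaussianWeight L).conj ψ) (t, x) ≤
      (L + T / 2) * observation L T ψ := by
  have hT : 0 < T := ht.1.trans_le ht.2
  have h := (admissible_gaussianWeight L t).energy_le_observation hL ht.1 (hψ.mono ht.2)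
  rw [← intervalIntegral.integral_const_mul] at h
  refine h.trans ?_
  simp only [gaussianWeight, Nat.cast_one, one_mul]
  gcongr
  exacts [observation_nonneg ht.1.le, ht.2, observation_mono hψ.smooth ht.1.le ht.2]

theorem integrableOn_norm_sq_conj {W : Carleman} (hW : W.Admissible L T) (hψ : Continuous ψ) :
    IntegrableOn (fun p => ‖W.conj ψ p‖ ^ 2) (rect L 0 T) := by
  have hmeas : Measurable fun p => ‖W.conj ψ p‖ ^ 2 :=
    (W.measurable_weight.smul hψ.measurable).norm.pow_const 2
  refine (integrableOn_norm_sq_rect hψ 0 T).mono' hmeas.aestronglyMeasurable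
    (ae_restrict_of_forall_mem (isCompact_rect L 0 T).measurableSet fun p hp => ?_)
  rw [Real.norm_of_nonneg (sq_nonneg _)]
  exact pow_le_pow_left₀ (norm_nonneg _) (hW.norm_weight_smul_le hp.1.1 hp.2 _) 2

theorem integral_norm_sq_conj_gaussianWeight_le (hL : 0 ≤ L) {C : ℝ} (hψ : IsTest L T ψ)
    (hfinal : ∫ x in -L..L, ‖ψ (T, x)‖ ^ 2 ≤ C * observation L T ψ) {a : ℝ} (ha : a ∈ Ioc 0 T) :
    ∫ p in rect L a T, ‖(gaussianWeight L).conj ψ p‖ ^ 2 ≤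
      2 * (T * C + 2 * T ^ 2 + 2 * T * (L + T / 2)) * observation L T ψ := by
  set W := gaussianWeight L
  have hW : W.Admissible L T := admissible_gaussianWeight L T
  have hT : 0 < T := ha.1.trans_le ha.2
  have hpos : ∀ p ∈ rect L a T, p.1 ≠ 0 := fun p hp => (ha.1.trans_le hp.1.1).ne'
  have hθ : ∀ p ∈ rect L a T, ContDiffAt ℝ ∞ (W.conj ψ) p := fun p hp =>
    W.contDiffAt_conj (hpos p hp) hψ.smooth.contDiffAt
  have hzero {x : ℝ} (h0 : ∀ t ∈ Icc 0 T, ψ (t, x) = 0) : ∀ t ∈ Icc a T, W.conj ψ (t, x) = 0 :=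
    fun t ht => by rw [conj, h0 t ⟨ha.1.le.trans ht.1, ht.2⟩, smul_zero]
  have hmain := W.integral_norm_sq_le_energy hL ha.1 ha.2 hθ (hzero hψ.left) (hzero hψ.right)
  have hfin : ∫ x in -L..L, ‖W.conj ψ (T, x)‖ ^ 2 ≤ C * observation L T ψ := by
    have hcont := hψ.smooth.continuous
    refine hfinal.trans' (intervalIntegral.integral_mono_on (neg_le_self hL)
      (Continuous.intervalIntegrable ?_ _ _) (Continuous.intervalIntegrable (by fun_prop) _ _)
      fun x hx => pow_le_pow_left₀ (norm_nonneg _)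
        (hW.norm_weight_smul_le (p := (T, x)) hT.le hx _) 2)
    simp only [conj, weight, phase]
    fun_prop
  have hsource := (hW.integral_pow_mul_conjHeat_conj_le hψ.smooth 2 ha.1 ha.2).trans
    (mul_le_mul_of_nonneg_left (integral_heat_le_observation hT.le) (sq_nonneg T))
  have henergy : ∫ p in rect L a T, p.1 * W.energyDensity (W.conj ψ) p ≤
      T * ((L + T / 2) * observation L T ψ) := by
    have hobs : 0 ≤ observation L T ψ := observation_nonneg hT.le
    refine (integral_rect_le_mul hL ha.2 (integrableOn_rect fun p hp => continuousAt_fst.mul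
      (W.contDiffAt_energyDensity (hpos p hp) (hθ p hp)).continuousAt) fun t ht =>
        gaussianWeight_energy_le_observation hL hψ ⟨ha.1.trans_le ht.1, ht.2⟩).trans ?_
    gcongr
    linarith [ha.1]
  rw [integral_div] at hmain
  have hfinT := mul_le_mul_of_nonneg_left hfin hT.le
  linarith

theorem exists_integral_norm_sq_conj_gaussianWeight_le (hL : 0 < L) (hT : 0 < T) :
    ∃ C, 0 ≤ C ∧ ∀ ψ, IsTest L T ψ →
      ∫ p in rect L 0 T, ‖(gaussianWeight L).conj ψ p‖ ^ 2 ≤ C * observation L T ψ := by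
  obtain ⟨C, hC, hfinal⟩ := exists_integral_final_le_observation hL hT
  refine ⟨2 * (T * C + 2 * T ^ 2 + 2 * T * (L + T / 2)), by positivity, fun ψ hψ => ?_⟩
  exact integral_rect_le_of_forall_lt hL.le hT
    (integrableOn_norm_sq_conj (admissible_gaussianWeight L T) hψ.smooth.continuous)
    fun a ha => integral_norm_sq_conj_gaussianWeight_le hL.le hψ (hfinal ψ hψ) ha

end Gaussian

section Duality

variable {𝕜 V H : Type*} [RCLike 𝕜] [AddCommGroup V] [Module 𝕜 V]

theorem exists_inner_eq_of_norm_le [NormedAddCommGroup H] [InnerProductSpace 𝕜 H]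
    [CompleteSpace H] (Λ : V →ₗ[𝕜] H) (ℓ : V →ₗ[𝕜] 𝕜) (C : ℝ)
    (h : ∀ v, ‖ℓ v‖ ≤ C * ‖Λ v‖) : ∃ k : H, ∀ v, ⟪k, Λ v⟫_𝕜 = ℓ v := by
  have hker : ℓ ∈ Λ.dualMap.range := by
    rw [LinearMap.range_dualMap_eq_dualAnnihilator_ker, Submodule.mem_dualAnnihilator]
    intro v hv
    simpa [LinearMap.mem_ker.1 hv] using h v
  obtain ⟨m, rfl⟩ := hker
  obtain ⟨F, hF, -⟩ := exists_extension_norm_eq (LinearMap.range Λ)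
    ((m.domRestrict (LinearMap.range Λ)).mkContinuous C (by
      rintro ⟨_, v, rfl⟩
      exact h v))
  refine ⟨(InnerProductSpace.toDual 𝕜 H).symm F, fun v => ?_⟩
  rw [InnerProductSpace.toDual_symm_apply]
  exact hF ⟨Λ v, v, rfl⟩

end Duality

section SquareIntegrable

variable {𝕜 V α : Type*} [RCLike 𝕜] [AddCommGroup V] [Module 𝕜 V] [MeasurableSpace α]
  {μ : Measure α} {f g : α → 𝕜}

theorem inner_toLp (k : Lp 𝕜 2 μ) (hf : MemLp f 2 μ) :
    ⟪k, hf.toLp f⟫_𝕜 = ∫ x, star (k x) * f x ∂μ := by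
  rw [L2.inner_def]
  refine integral_congr_ae ?_
  filter_upwards [hf.coeFn_toLp] with x hx
  rw [hx, RCLike.inner_apply', starRingEnd_apply]

theorem norm_sq_eq_integral (f : Lp 𝕜 2 μ) : ‖f‖ ^ 2 = ∫ x, ‖f x‖ ^ 2 ∂μ := by
  have hinner := L2.inner_def (𝕜 := 𝕜) f f
  simp only [inner_self_eq_norm_sq_to_K, ← RCLike.ofReal_pow, integral_ofReal] at hinner
  exact RCLike.ofReal_injective hinner

theorem norm_toLp_sq (hf : MemLp f 2 μ) : ‖hf.toLp f‖ ^ 2 = ∫ x, ‖f x‖ ^ 2 ∂μ := by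
  rw [norm_sq_eq_integral]
  exact integral_congr_ae (hf.coeFn_toLp.mono fun x hx => by simp only [hx])

theorem norm_integral_mul_le_sqrt (hf : MemLp f 2 μ) (hg : MemLp g 2 μ) :
    ‖∫ x, f x * g x ∂μ‖ ≤ √(∫ x, ‖f x‖ ^ 2 ∂μ) * √(∫ x, ‖g x‖ ^ 2 ∂μ) := by
  have hholder := integral_mul_le_Lp_mul_Lq_of_nonneg (μ := μ) Real.HolderConjugate.two_two
    (f := fun x => ‖f x‖) (g := fun x => ‖g x‖) (.of_forall fun _ => norm_nonneg _)
    (.of_forall fun _ => norm_nonneg _) (by simpa using hf.norm) (by simpa using hg.norm)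
  calc ‖∫ x, f x * g x ∂μ‖ ≤ ∫ x, ‖f x * g x‖ ∂μ := norm_integral_le_integral_norm _
    _ ≤ _ := by simpa only [norm_mul, Real.sqrt_eq_rpow, Real.rpow_two] using hholder

/-- A linear map into the square integrable functions, as a linear map into `L²`. -/
def linearToLp (D : V →ₗ[𝕜] α → 𝕜) (hD : ∀ v, MemLp (D v) 2 μ) : V →ₗ[𝕜] Lp 𝕜 2 μ where
  toFun v := (hD v).toLp (D v)
  map_add' v w := by
    rw [← MemLp.toLp_add]
    exact MemLp.toLp_congr _ _ (by rw [map_add])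
  map_smul' c v := by
    rw [RingHom.id_apply, ← MemLp.toLp_const_smul]
    exact MemLp.toLp_congr _ _ (by rw [map_smul])

end SquareIntegrable

section Reversal

variable {L T : ℝ} {φ ψ : ℝ × ℝ → ℂ}

/-- The adjoint `-∂ₜ - ∂ₓₓ` of the heat operator, as a function of the space-time point. -/
def adjointHeat (φ : ℝ × ℝ → ℂ) (p : ℝ × ℝ) : ℂ := -dt φ p.1 p.2 - dxx φ p.1 p.2

/-- The time reversal `(t, x) ↦ φ (T - t, x)`, which exchanges the heat operator and its adjoint. -/
def reversed (T : ℝ) (φ : ℝ × ℝ → ℂ) (p : ℝ × ℝ) : ℂ := φ (T - p.1, p.2)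

theorem continuous_adjointHeat (hφ : ContDiff ℝ ∞ φ) : Continuous (adjointHeat φ) :=
  continuous_iff_continuousAt.2 fun _ =>
    (contDiffAt_dt hφ.contDiffAt).continuousAt.neg.sub (contDiffAt_dxx hφ.contDiffAt).continuousAt

theorem continuous_dx_slice (hφ : ContDiff ℝ ∞ φ) (x : ℝ) : Continuous fun t => dx φ t x :=
  (continuous_dx hφ).comp (by fun_prop : Continuous fun t : ℝ => (t, x))

theorem IsTest.reversed (hφ : IsTest L T φ) : IsTest L T (reversed T φ) where
  smooth := hφ.smooth.comp (by fun_prop : ContDiff ℝ ∞ fun p : ℝ × ℝ => (T - p.1, p.2))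
  left t ht := hφ.left (T - t) ⟨sub_nonneg.2 ht.2, sub_le_self T ht.1⟩
  right t ht := hφ.right (T - t) ⟨sub_nonneg.2 ht.2, sub_le_self T ht.1⟩

theorem dx_reversed (T : ℝ) (φ : ℝ × ℝ → ℂ) (t x : ℝ) :
    dx (reversed T φ) t x = dx φ (T - t) x := rfl

theorem heat_reversed (T : ℝ) (φ : ℝ × ℝ → ℂ) (p : ℝ × ℝ) :
    heat (reversed T φ) p = adjointHeat φ (T - p.1, p.2) :=
  congrArg (· - dxx φ (T - p.1) p.2) (deriv_comp_const_sub (f := fun s => φ (s, p.2)) T p.1)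

theorem observation_reversed (hL : 0 ≤ L) (hT : 0 ≤ T) (hφ : ContDiff ℝ ∞ φ) :
    observation L T (reversed T φ) =
      (∫ t in 0..T, (‖dx φ t (-L)‖ ^ 2 + ‖dx φ t L‖ ^ 2)) +
        ∫ p in rect L 0 T, ‖adjointHeat φ p‖ ^ 2 := by
  have hcont := continuous_adjointHeat hφ
  have hcont' : Continuous fun p : ℝ × ℝ => adjointHeat φ (T - p.1, p.2) :=
    hcont.comp (by fun_prop)
  simp only [observation, dx_reversed, heat_reversed]
  rw [integral_rect_eq hL hT (integrableOn_norm_sq_rect hcont 0 T), integral_rect_eq hL hT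
    (integrableOn_norm_sq_rect hcont' 0 T),
    intervalIntegral.integral_comp_sub_left (fun t => ‖dx φ t (-L)‖ ^ 2 + ‖dx φ t L‖ ^ 2) T,
    intervalIntegral.integral_comp_sub_left (fun t => ∫ x in -L..L, ‖adjointHeat φ (t, x)‖ ^ 2) T]
  simp only [sub_self, sub_zero]

end Reversal

section Cylinder

variable {L T : ℝ}

/-- The open space-time cylinder `(0, T) × (-L, L)`. -/
abbrev cylinder (L T : ℝ) : Set (ℝ × ℝ) := Ioo 0 T ×ˢ Ioo (-L) L

theorem setIntegral_cylinder {E : Type*} [NormedAddCommGroup E] [NormedSpace ℝ E]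
    (f : ℝ × ℝ → E) : ∫ p in cylinder L T, f p = ∫ p in rect L 0 T, f p :=
  setIntegral_congr_set (Measure.set_prod_ae_eq Ioo_ae_eq_Icc Ioo_ae_eq_Icc)

theorem memLp_two_restrict_of_continuous {X 𝕜 : Type*} [RCLike 𝕜] [TopologicalSpace X]
    [T2Space X] [MeasurableSpace X] [OpensMeasurableSpace X] {μ : Measure X}
    [IsFiniteMeasureOnCompacts μ] {s K : Set X} (hK : IsCompact K) (hs : s ⊆ K)
    {f : X → 𝕜} (hf : Continuous f) : MemLp f 2 (μ.restrict s) :=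
  (memLp_two_iff_integrable_sq_norm hf.aestronglyMeasurable).2
    ((((hf.norm.pow 2).continuousOn).integrableOn_compact hK).mono_set hs)

theorem memLp_cylinder {f : ℝ × ℝ → ℂ} (hf : Continuous f) :
    MemLp f 2 (volume.restrict (cylinder L T)) :=
  memLp_two_restrict_of_continuous (isCompact_rect L 0 T)
    (prod_mono Ioo_subset_Icc_self Ioo_subset_Icc_self) hf

theorem memLp_Ioo {f : ℝ → ℂ} (hf : Continuous f) (a b : ℝ) :
    MemLp f 2 (volume.restrict (Ioo a b)) :=
  memLp_two_restrict_of_continuous isCompact_Icc Ioo_subset_Icc_self hf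

end Cylinder

section Linear

variable {φ ψ : ℝ × ℝ → ℂ} {t x : ℝ}

theorem dt_add (hφ : DifferentiableAt ℝ φ (t, x)) (hψ : DifferentiableAt ℝ ψ (t, x)) :
    dt (φ + ψ) t x = dt φ t x + dt ψ t x :=
  ((hasDerivAt_dt hφ).add (hasDerivAt_dt hψ)).deriv

theorem dx_add (hφ : DifferentiableAt ℝ φ (t, x)) (hψ : DifferentiableAt ℝ ψ (t, x)) :
    dx (φ + ψ) t x = dx φ t x + dx ψ t x :=
  ((hasDerivAt_dx hφ).add (hasDerivAt_dx hψ)).deriv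

theorem dxx_add (hφ : ContDiff ℝ ∞ φ) (hψ : ContDiff ℝ ∞ ψ) :
    dxx (φ + ψ) t x = dxx φ t x + dxx ψ t x := by
  have hslice (f : ℝ × ℝ → ℂ) (hf : ContDiff ℝ ∞ f) : ContDiffAt ℝ 2 (fun y => f (t, y)) x :=
    ((hf.of_le ENat.LEInfty.out).comp (by fun_prop : ContDiff ℝ 2 fun y : ℝ => (t, y))).contDiffAt
  exact iteratedDeriv_add (hslice φ hφ) (hslice ψ hψ)

theorem dt_smul (c : ℂ) (φ : ℝ × ℝ → ℂ) (t x : ℝ) : dt (c • φ) t x = c • dt φ t x :=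
  deriv_const_smul_field c _

theorem dx_smul (c : ℂ) (φ : ℝ × ℝ → ℂ) (t x : ℝ) : dx (c • φ) t x = c • dx φ t x :=
  deriv_const_smul_field c _

theorem dxx_smul (c : ℂ) (φ : ℝ × ℝ → ℂ) (t x : ℝ) : dxx (c • φ) t x = c • dxx φ t x :=
  iteratedDeriv_const_smul_field c _

end Linear

section Tests

variable {L T : ℝ}

/-- The complex vector space of test functions. -/
def tests (L T : ℝ) : Submodule ℂ (ℝ × ℝ → ℂ) where
  carrier := {φ | IsTest L T φ}
  add_mem' hφ hψ := ⟨hφ.smooth.add hψ.smooth, fun t ht => by simp [hφ.left t ht, hψ.left t ht],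
    fun t ht => by simp [hφ.right t ht, hψ.right t ht]⟩
  zero_mem' := ⟨contDiff_const, fun _ _ => rfl, fun _ _ => rfl⟩
  smul_mem' c _ hφ := ⟨hφ.smooth.const_smul c, fun t ht => by simp [hφ.left t ht],
    fun t ht => by simp [hφ.right t ht]⟩

/-- The adjoint heat operator on test functions. -/
def adjointHeatLinear (L T : ℝ) : tests L T →ₗ[ℂ] ℝ × ℝ → ℂ where
  toFun φ := adjointHeat φ
  map_add' φ ψ := by
    funext p
    simp only [adjointHeat, Submodule.coe_add, Pi.add_apply, dxx_add φ.2.smooth ψ.2.smooth,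
      dt_add (φ.2.smooth.differentiable (by simp) p) (ψ.2.smooth.differentiable (by simp) p)]
    ring
  map_smul' c φ := by
    funext p
    simp only [adjointHeat, Submodule.coe_smul, Pi.smul_apply, dt_smul, dxx_smul,
      RingHom.id_apply, smul_sub, smul_neg]

/-- The normal derivative of a test function along the line at `x`. -/
def dxLinear (L T x : ℝ) : tests L T →ₗ[ℂ] ℝ → ℂ where
  toFun φ t := dx φ t x
  map_add' φ ψ := by
    funext t
    exact dx_add (φ.2.smooth.differentiable (by simp) (t, x))
      (ψ.2.smooth.differentiable (by simp) (t, x))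
  map_smul' c φ := by
    funext t
    exact dx_smul c φ t x

theorem memLp_adjointHeatLinear (φ : tests L T) :
    MemLp (adjointHeatLinear L T φ) 2 (volume.restrict (cylinder L T)) :=
  memLp_cylinder (continuous_adjointHeat φ.2.smooth)

theorem memLp_dxLinear (x : ℝ) (φ : tests L T) :
    MemLp (dxLinear L T x φ) 2 (volume.restrict (Ioo 0 T)) :=
  memLp_Ioo (continuous_dx_slice φ.2.smooth x) 0 T

/-- The Hilbert space of the observed data: a source term and two boundary traces. -/
abbrev ObservationSpace (L T : ℝ) : Type :=
  WithLp 2 (Lp ℂ 2 (volume.restrict (cylinder L T)) ×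
    WithLp 2 (Lp ℂ 2 (volume.restrict (Ioo 0 T)) × Lp ℂ 2 (volume.restrict (Ioo 0 T))))

/-- The source term of the adjoint equation and the two normal derivatives of a test function. -/
def observe (L T : ℝ) : tests L T →ₗ[ℂ] ObservationSpace L T :=
  (WithLp.linearEquiv 2 ℂ _).symm.toLinearMap ∘ₗ
    (linearToLp (adjointHeatLinear L T) memLp_adjointHeatLinear).prod
      ((WithLp.linearEquiv 2 ℂ _).symm.toLinearMap ∘ₗ
        (linearToLp (dxLinear L T (-L)) (memLp_dxLinear (-L))).prod
          (linearToLp (dxLinear L T L) (memLp_dxLinear L)))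

theorem inner_observe (k : ObservationSpace L T) (φ : tests L T) :
    ⟪k, observe L T φ⟫_ℂ = (∫ p in cylinder L T, star (k.fst p) * adjointHeat φ p) +
      ((∫ t in Ioo 0 T, star (k.snd.fst t) * dx φ t (-L)) +
        ∫ t in Ioo 0 T, star (k.snd.snd t) * dx φ t L) := by
  rw [WithLp.prod_inner_apply, WithLp.prod_inner_apply]
  exact congrArg₂ (· + ·) (inner_toLp _ (memLp_adjointHeatLinear φ))
    (congrArg₂ (· + ·) (inner_toLp _ (memLp_dxLinear (-L) φ)) (inner_toLp _ (memLp_dxLinear L φ)))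

theorem norm_sq_observe (hL : 0 ≤ L) (hT : 0 ≤ T) (φ : tests L T) :
    ‖observe L T φ‖ ^ 2 = observation L T (reversed T φ) := by
  have hleft := continuous_dx_slice φ.2.smooth (-L)
  have hright := continuous_dx_slice φ.2.smooth L
  have hsource : ‖(observe L T φ).fst‖ ^ 2 = ∫ p in cylinder L T, ‖adjointHeat φ p‖ ^ 2 :=
    norm_toLp_sq (memLp_adjointHeatLinear φ)
  have htrace_left : ‖(observe L T φ).snd.fst‖ ^ 2 = ∫ t in Ioo 0 T, ‖dx φ t (-L)‖ ^ 2 :=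
    norm_toLp_sq (memLp_dxLinear (-L) φ)
  have htrace_right : ‖(observe L T φ).snd.snd‖ ^ 2 = ∫ t in Ioo 0 T, ‖dx φ t L‖ ^ 2 :=
    norm_toLp_sq (memLp_dxLinear L φ)
  rw [observation_reversed hL hT φ.2.smooth, WithLp.prod_norm_sq_eq_of_L2,
    WithLp.prod_norm_sq_eq_of_L2, hsource, htrace_left, htrace_right, setIntegral_cylinder,
    intervalIntegral.integral_add (Continuous.intervalIntegrable (by fun_prop) _ _)
      (Continuous.intervalIntegrable (by fun_prop) _ _)]
  simp only [intervalIntegral.integral_of_le hT, integral_Ioc_eq_integral_Ioo]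
  ring

/-- The pairing of a state with the final values of test functions. -/
def finalPairing (T : ℝ) (f : State L) : tests L T →ₗ[ℂ] ℂ where
  toFun φ := ∫ x in Ioo (-L) L, f x * (φ : ℝ × ℝ → ℂ) (T, x)
  map_add' φ ψ := by
    have hint (φ : tests L T) : Integrable (fun x => f x * (φ : ℝ × ℝ → ℂ) (T, x))
        (intervalMeasure L) :=
      (Lp.memLp f).integrable_mul (memLp_Ioo (φ.2.smooth.continuous.comp
        (by fun_prop : Continuous fun x : ℝ => (T, x))) (-L) L)
    simp only [Submodule.coe_add, Pi.add_apply, mul_add, integral_add (hint φ) (hint ψ)]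
  map_smul' c φ := by
    simp only [Submodule.coe_smul, Pi.smul_apply, mul_smul_comm, integral_smul, RingHom.id_apply]

theorem mem_reachableSetAt_of_norm_le (hL : 0 ≤ L) (hT : 0 ≤ T) {f : State L} {C : ℝ}
    (h : ∀ φ, IsTest L T φ →
      ‖∫ x in Ioo (-L) L, f x * φ (T, x)‖ ≤ C * √(observation L T (reversed T φ))) :
    f ∈ reachableSetAt L T := by
  obtain ⟨k, hk⟩ := exists_inner_eq_of_norm_le (observe L T) (finalPairing T f) C fun φ => by
    rw [← Real.sqrt_sq (norm_nonneg (observe L T φ)), norm_sq_observe hL hT]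
    exact h φ φ.2
  have hleft := (Lp.memLp k.snd.fst).star
  have hright := (Lp.memLp k.snd.snd).star
  refine ⟨_, _, hleft, hright.neg, _, (Lp.memLp k.fst).star.neg, fun φ hφ => ?_⟩
  have hpairing : ∫ x in Ioo (-L) L, f x * φ (T, x) = _ :=
    (hk ⟨φ, hφ⟩).symm.trans (inner_observe k ⟨φ, hφ⟩)
  have hint_left : IntegrableOn (fun t => star (k.snd.fst t) * dx φ t (-L)) (Ioo 0 T) :=
    hleft.integrable_mul (memLp_Ioo (continuous_dx_slice hφ.smooth (-L)) 0 T)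
  have hint_right : IntegrableOn (fun t => star (k.snd.snd t) * dx φ t L) (Ioo 0 T) :=
    hright.integrable_mul (memLp_Ioo (continuous_dx_slice hφ.smooth L) 0 T)
  rw [hpairing]
  simp only [Pi.neg_apply, Pi.star_apply, neg_mul, sub_neg_eq_add, integral_neg, adjointHeat]
  rw [integral_add hint_left hint_right]
  ring

end Tests

section Cutoff

variable {L T t₀ t : ℝ} {ψ : ℝ × ℝ → ℂ} {p : ℝ × ℝ}

/-- A smooth cutoff in time, equal to `1` before `t₀ / 2` and to `0` after `t₀`. -/
def cutoff (t₀ t : ℝ) : ℝ := Real.smoothTransition (2 - 2 * t / t₀)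

/-- The function `ψ` cut off in time, so that it vanishes after `t₀`. -/
def truncated (t₀ : ℝ) (ψ : ℝ × ℝ → ℂ) (p : ℝ × ℝ) : ℂ := cutoff t₀ p.1 • ψ p

theorem contDiff_cutoff (t₀ : ℝ) : ContDiff ℝ ∞ (cutoff t₀) :=
  Real.smoothTransition.contDiff.comp (by fun_prop)

theorem cutoff_nonneg (t₀ t : ℝ) : 0 ≤ cutoff t₀ t := Real.smoothTransition.nonneg _

theorem cutoff_le_one (t₀ t : ℝ) : cutoff t₀ t ≤ 1 := Real.smoothTransition.le_one _

theorem cutoff_of_le (ht₀ : 0 < t₀) (ht : t ≤ t₀ / 2) : cutoff t₀ t = 1 := by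
  refine Real.smoothTransition.one_of_one_le ?_
  have : 2 * t / t₀ ≤ 1 := (div_le_one ht₀).2 (by linarith)
  linarith

theorem cutoff_of_ge (ht₀ : 0 < t₀) (ht : t₀ ≤ t) : cutoff t₀ t = 0 := by
  refine Real.smoothTransition.zero_of_nonpos ?_
  have : 2 ≤ 2 * t / t₀ := (le_div_iff₀ ht₀).2 (by linarith)
  linarith

theorem deriv_cutoff_of_le (ht₀ : 0 < t₀) (ht : t ≤ t₀ / 2) : deriv (cutoff t₀) t = 0 :=
  IsLocalMax.deriv_eq_zero <| .of_forall fun s =>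
    (cutoff_le_one t₀ s).trans_eq (cutoff_of_le ht₀ ht).symm

theorem deriv_cutoff_of_ge (ht₀ : 0 < t₀) (ht : t₀ ≤ t) : deriv (cutoff t₀) t = 0 :=
  IsLocalMin.deriv_eq_zero <| .of_forall fun s =>
    (cutoff_of_ge ht₀ ht).trans_le (cutoff_nonneg t₀ s)

theorem norm_cutoff_smul_le (t₀ t : ℝ) (z : ℂ) : ‖cutoff t₀ t • z‖ ≤ ‖z‖ := by
  rw [norm_smul, Real.norm_of_nonneg (cutoff_nonneg t₀ t)]
  exact mul_le_of_le_one_left (norm_nonneg z) (cutoff_le_one t₀ t)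

theorem contDiff_truncated (t₀ : ℝ) (hψ : ContDiff ℝ ∞ ψ) : ContDiff ℝ ∞ (truncated t₀ ψ) :=
  ((contDiff_cutoff t₀).comp contDiff_fst).smul hψ

theorem truncated_of_ge (ht₀ : 0 < t₀) (hp : t₀ ≤ p.1) : truncated t₀ ψ p = 0 := by
  rw [truncated, cutoff_of_ge ht₀ hp, zero_smul]

theorem IsTest.truncated (ht₀ : 0 < t₀) (hψ : IsTest L t₀ ψ) (T : ℝ) :
    IsTest L T (truncated t₀ ψ) := by
  have hzero {x : ℝ} (h : ∀ t ∈ Icc 0 t₀, ψ (t, x) = 0) (t : ℝ) (ht : 0 ≤ t) :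
      HeatReach.truncated t₀ ψ (t, x) = 0 := by
    rcases le_total t₀ t with hge | hle
    · exact truncated_of_ge ht₀ hge
    · rw [HeatReach.truncated, h t ⟨ht, hle⟩, smul_zero]
  exact ⟨contDiff_truncated t₀ hψ.smooth, fun t ht => hzero hψ.left t ht.1,
    fun t ht => hzero hψ.right t ht.1⟩

theorem heat_truncated (t₀ : ℝ) (hψ : ContDiff ℝ ∞ ψ) (p : ℝ × ℝ) :
    heat (truncated t₀ ψ) p = deriv (cutoff t₀) p.1 • ψ p + cutoff t₀ p.1 • heat ψ p := by
  have hcutoff : HasDerivAt (cutoff t₀) (deriv (cutoff t₀) p.1) p.1 :=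
    ((contDiff_cutoff t₀).differentiable (by simp) p.1).hasDerivAt
  have hdt := (hcutoff.smul (hasDerivAt_dt (hψ.differentiable (by simp) p))).deriv
  have hdxx : dxx (truncated t₀ ψ) p.1 p.2 = cutoff t₀ p.1 • dxx ψ p.1 p.2 :=
    iteratedDeriv_const_smul_field (n := 2) (cutoff t₀ p.1) fun y => ψ (p.1, y)
  rw [heat, heat, hdxx]
  refine (congrArg (· - _) hdt).trans ?_
  module

theorem norm_conj_truncated_le (W : Carleman) (t₀ : ℝ) (ψ : ℝ × ℝ → ℂ) (p : ℝ × ℝ) :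
    ‖W.conj (truncated t₀ ψ) p‖ ≤ ‖W.conj ψ p‖ := by
  rw [Carleman.conj, truncated, smul_comm]
  exact norm_cutoff_smul_le _ _ _

theorem exp_mul_gaussianWeight_sq_ge_one (ht₀ : 0 < t₀) (hp : t₀ / 2 ≤ p.1) :
    1 ≤ Real.exp (L ^ 2 / t₀) * (gaussianWeight L).weight p ^ 2 := by
  have hle : (L ^ 2 - p.2 ^ 2) / (2 * p.1) ≤ L ^ 2 / t₀ :=
    div_le_div₀ (sq_nonneg L) (sub_le_self _ (sq_nonneg p.2)) ht₀ (by linarith)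
  rw [gaussianWeight_weight_sq, ← Real.exp_add]
  exact Real.one_le_exp (by linarith)

theorem norm_sq_deriv_cutoff_smul_le (ht₀ : 0 < t₀) {D : ℝ} (hD : |deriv (cutoff t₀) p.1| ≤ D) :
    ‖deriv (cutoff t₀) p.1 • ψ p‖ ^ 2 ≤
      D ^ 2 * Real.exp (L ^ 2 / t₀) * ‖(gaussianWeight L).conj ψ p‖ ^ 2 := by
  rcases le_total p.1 (t₀ / 2) with hp | hp
  · rw [deriv_cutoff_of_le ht₀ hp, zero_smul, norm_zero, zero_pow two_ne_zero]
    positivity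
  · rw [Carleman.conj, norm_smul, norm_smul, mul_pow, mul_pow, Real.norm_eq_abs, Real.norm_eq_abs,
      sq_abs ((gaussianWeight L).weight p)]
    calc |deriv (cutoff t₀) p.1| ^ 2 * ‖ψ p‖ ^ 2 ≤ D ^ 2 * ‖ψ p‖ ^ 2 * 1 := by
          rw [mul_one]
          gcongr
      _ ≤ D ^ 2 * ‖ψ p‖ ^ 2 * (Real.exp (L ^ 2 / t₀) * (gaussianWeight L).weight p ^ 2) := by
          gcongr
          exact exp_mul_gaussianWeight_sq_ge_one ht₀ hp
      _ = _ := by ring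

theorem norm_sq_heat_truncated_le (ht₀ : 0 < t₀) (hψ : ContDiff ℝ ∞ ψ) {D : ℝ}
    (hD : |deriv (cutoff t₀) p.1| ≤ D) :
    ‖heat (truncated t₀ ψ) p‖ ^ 2 ≤
      2 * (D ^ 2 * Real.exp (L ^ 2 / t₀) * ‖(gaussianWeight L).conj ψ p‖ ^ 2 +
        ‖heat ψ p‖ ^ 2) := by
  rw [heat_truncated t₀ hψ]
  refine (pow_le_pow_left₀ (norm_nonneg _) (norm_add_le _ _) 2).trans (add_sq_le.trans ?_)
  gcongr
  exacts [norm_sq_deriv_cutoff_smul_le ht₀ hD, norm_cutoff_smul_le _ _ _]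

theorem setIntegral_cylinder_eq_of_forall_ge {E : Type*} [NormedAddCommGroup E] [NormedSpace ℝ E]
    (hT : t₀ ≤ T) {f : ℝ × ℝ → E} (hf : ∀ p : ℝ × ℝ, t₀ ≤ p.1 → f p = 0) :
    ∫ p in cylinder L T, f p = ∫ p in cylinder L t₀, f p := by
  refine setIntegral_eq_of_subset_of_forall_sdiff_eq_zero
    (measurableSet_Ioo.prod measurableSet_Ioo) (prod_mono (Ioo_subset_Ioo_right hT) subset_rfl)
    fun p hp => hf p (not_lt.1 fun hlt => hp.2 ⟨⟨hp.1.1.1, hlt⟩, hp.1.2⟩)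

theorem integral_norm_sq_conj_truncated_le (ht₀ : 0 < t₀) (hT : t₀ ≤ T) (hψ : Continuous ψ) :
    ∫ p in cylinder L T, ‖(gaussianWeight L).conj (truncated t₀ ψ) p‖ ^ 2 ≤
      ∫ p in rect L 0 t₀, ‖(gaussianWeight L).conj ψ p‖ ^ 2 := by
  have hψ' : Continuous (truncated t₀ ψ) :=
    ((contDiff_cutoff t₀).continuous.comp continuous_fst).smul hψ
  rw [setIntegral_cylinder_eq_of_forall_ge hT fun p hp => by
    rw [Carleman.conj, truncated_of_ge ht₀ hp, smul_zero, norm_zero, zero_pow two_ne_zero],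
    setIntegral_cylinder]
  exact integral_mono (integrableOn_norm_sq_conj (admissible_gaussianWeight L t₀) hψ')
    (integrableOn_norm_sq_conj (admissible_gaussianWeight L t₀) hψ)
    fun p => pow_le_pow_left₀ (norm_nonneg _) (norm_conj_truncated_le _ t₀ ψ p) 2

theorem integral_norm_sq_heat_truncated_le (ht₀ : 0 < t₀) (hT : t₀ ≤ T) (hψ : ContDiff ℝ ∞ ψ)
    {D : ℝ} (hD : ∀ t ∈ Icc 0 t₀, |deriv (cutoff t₀) t| ≤ D) :
    ∫ p in cylinder L T, ‖heat (truncated t₀ ψ) p‖ ^ 2 ≤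
      2 * (D ^ 2 * Real.exp (L ^ 2 / t₀) *
          (∫ p in rect L 0 t₀, ‖(gaussianWeight L).conj ψ p‖ ^ 2) +
        ∫ p in rect L 0 t₀, ‖heat ψ p‖ ^ 2) := by
  have hconj := (integrableOn_norm_sq_conj (admissible_gaussianWeight L t₀)
    hψ.continuous).const_mul (D ^ 2 * Real.exp (L ^ 2 / t₀))
  have hheat := integrableOn_norm_sq_rect (L := L) (continuous_heat hψ) 0 t₀
  rw [setIntegral_cylinder_eq_of_forall_ge hT fun p hp => by
    rw [heat_truncated t₀ hψ, deriv_cutoff_of_ge ht₀ hp, cutoff_of_ge ht₀ hp, zero_smul, zero_smul,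
      add_zero, norm_zero, zero_pow two_ne_zero],
    setIntegral_cylinder, ← integral_const_mul, ← integral_add hconj hheat, ← integral_const_mul]
  exact setIntegral_mono_on
    (integrableOn_norm_sq_rect (continuous_heat (contDiff_truncated t₀ hψ)) 0 t₀)
    ((hconj.fun_add hheat).const_mul 2) (isCompact_rect L 0 t₀).measurableSet
    fun p hp => norm_sq_heat_truncated_le ht₀ hψ (hD p.1 hp.1)

end Cutoff

section Pairings

variable {L T : ℝ} {g ψ : ℝ × ℝ → ℂ}

theorem norm_integral_mul_le_weighted (L T : ℝ)
    (hg : AEStronglyMeasurable g (volume.restrict (cylinder L T)))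
    (hgw : IntegrableOn (fun p : ℝ × ℝ => ‖g p‖ ^ 2 * Real.exp ((L ^ 2 - p.2 ^ 2) / (2 * p.1)))
      (cylinder L T)) (hψ : Continuous ψ) :
    ‖∫ p in cylinder L T, g p * ψ p‖ ≤
      √(∫ p in cylinder L T, ‖g p‖ ^ 2 * Real.exp ((L ^ 2 - p.2 ^ 2) / (2 * p.1))) *
        √(∫ p in cylinder L T, ‖(gaussianWeight L).conj ψ p‖ ^ 2) := by
  set W := gaussianWeight L
  have hnorm (p : ℝ × ℝ) : ‖(W.weight p)⁻¹ • g p‖ ^ 2 =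
      ‖g p‖ ^ 2 * Real.exp ((L ^ 2 - p.2 ^ 2) / (2 * p.1)) := by
    rw [norm_smul, mul_pow, norm_inv, inv_pow, Real.norm_eq_abs, sq_abs, gaussianWeight_weight_sq,
      Real.exp_neg, inv_inv, mul_comm]
  have hg2 : MemLp (fun p => (W.weight p)⁻¹ • g p) 2 (volume.restrict (cylinder L T)) :=
    (memLp_two_iff_integrable_sq_norm
      (W.measurable_weight.inv.aestronglyMeasurable.smul hg)).2
        (hgw.congr (.of_forall fun p => (hnorm p).symm))
  have hψ2 : MemLp (W.conj ψ) 2 (volume.restrict (cylinder L T)) :=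
    (memLp_two_iff_integrable_sq_norm
      (W.measurable_weight.smul hψ.measurable).aestronglyMeasurable).2
      ((integrableOn_norm_sq_conj (admissible_gaussianWeight L T) hψ).mono_set
        (prod_mono Ioo_subset_Icc_self Ioo_subset_Icc_self))
  have hmul (p : ℝ × ℝ) : g p * ψ p = (W.weight p)⁻¹ • g p * W.conj ψ p := by
    rw [Carleman.conj, smul_mul_smul_comm, inv_mul_cancel₀ (W.weight_pos p).ne', one_smul]
  simpa only [hmul, hnorm] using norm_integral_mul_le_sqrt hg2 hψ2

theorem memLp_two_sqrt {α : Type*} [MeasurableSpace α] {μ : Measure α} {m : α → ℝ}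
    (hm : Integrable m μ) (h0 : 0 ≤ m) : MemLp (fun t => √(m t)) 2 μ := by
  refine (memLp_two_iff_integrable_sq
    (Real.continuous_sqrt.comp_aestronglyMeasurable hm.1)).2 ?_
  simpa only [Real.sq_sqrt (h0 _)] using hm

theorem integral_sqrt_le {α : Type*} [MeasurableSpace α] {μ : Measure α} [IsFiniteMeasure μ]
    {m : α → ℝ} (hm : Integrable m μ) (h0 : 0 ≤ m) :
    ∫ t, √(m t) ∂μ ≤ √(μ.real univ) * √(∫ t, m t ∂μ) := by
  have hsq (t : α) : ‖√(m t)‖ ^ 2 = m t := by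
    rw [Real.norm_of_nonneg (Real.sqrt_nonneg _), Real.sq_sqrt (h0 t)]
  refine (Real.le_norm_self _).trans ?_
  simpa only [hsq, one_mul, norm_one, one_pow, integral_const, smul_eq_mul, mul_one] using
    norm_integral_mul_le_sqrt (memLp_const (1 : ℝ)) (memLp_two_sqrt hm h0)

theorem norm_integral_state_mul_le {B : ℝ} (hT : 0 ≤ T) {w : ℝ → State L} (hB : 0 ≤ B)
    (hw : ∀ t ∈ Ioo 0 T, ‖w t‖ ≤ B) (hψ : Continuous ψ) :
    ‖∫ t in Ioo 0 T, ∫ x in Ioo (-L) L, w t x * ψ (t, x)‖ ≤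
      B * (√T * √(∫ p in cylinder L T, ‖ψ p‖ ^ 2)) := by
  have hint : IntegrableOn (fun p => ‖ψ p‖ ^ 2) (cylinder L T) :=
    (memLp_cylinder hψ).integrable_norm_pow two_ne_zero
  have hslice : Integrable (fun t => ∫ x in Ioo (-L) L, ‖ψ (t, x)‖ ^ 2)
      (volume.restrict (Ioo 0 T)) := by
    rw [IntegrableOn, Measure.volume_eq_prod, ← Measure.prod_restrict] at hint
    exact hint.integral_prod_left
  have hslice_nonneg : 0 ≤ fun t => ∫ x in Ioo (-L) L, ‖ψ (t, x)‖ ^ 2 :=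
    fun t => integral_nonneg fun x => sq_nonneg _
  calc ‖∫ t in Ioo 0 T, ∫ x in Ioo (-L) L, w t x * ψ (t, x)‖
      ≤ ∫ t in Ioo 0 T, B * √(∫ x in Ioo (-L) L, ‖ψ (t, x)‖ ^ 2) := by
        refine norm_integral_le_of_norm_le
          (((memLp_two_sqrt hslice hslice_nonneg).integrable one_le_two).const_mul B)
          (ae_restrict_of_forall_mem measurableSet_Ioo fun t ht => ?_)
        refine (norm_integral_mul_le_sqrt (Lp.memLp (w t)) (memLp_Ioo (by fun_prop) _ _)).trans ?_
        rw [← norm_sq_eq_integral, Real.sqrt_sq (norm_nonneg _)]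
        gcongr
        exact hw t ht
    _ ≤ B * (√T * √(∫ p in cylinder L T, ‖ψ p‖ ^ 2)) := by
        rw [integral_const_mul, Measure.volume_eq_prod, setIntegral_prod _ hint]
        refine mul_le_mul_of_nonneg_left ((integral_sqrt_le hslice hslice_nonneg).trans_eq ?_) hB
        rw [measureReal_restrict_apply_univ, Real.volume_real_Ioo_of_le hT, sub_zero]

end Pairings

section Reachability

variable {L T : ℝ} {g : ℝ × ℝ → ℂ} {wT : State L} {w : ℝ → State L}

theorem IsBackwardSolution.integral_initial_eq (hw : IsBackwardSolution L T g wT w) {t₀ : ℝ}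
    (ht₀ : 0 < t₀) (hT : t₀ ≤ T) {ψ : ℝ × ℝ → ℂ} (hψ : IsTest L t₀ ψ) :
    ∫ x in Ioo (-L) L, w 0 x * ψ (0, x) =
      (∫ p in cylinder L T, g p * truncated t₀ ψ p) -
        ∫ t in Ioo 0 T, ∫ x in Ioo (-L) L, w t x * heat (truncated t₀ ψ) (t, x) := by
  have hid := hw.identity _ (hψ.truncated ht₀ T)
  have hfinal : ∫ x in Ioo (-L) L, wT x * truncated t₀ ψ (T, x) = 0 := by
    simp only [truncated_of_ge (p := (T, _)) ht₀ hT, mul_zero, integral_zero]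
  have hinitial (x : ℝ) : truncated t₀ ψ (0, x) = ψ (0, x) := by
    rw [truncated, cutoff_of_le ht₀ (by positivity), one_smul]
  simp only [hfinal, hinitial, add_zero] at hid
  simp only [heat, hid, sub_sub_cancel]

theorem IsBackwardSolution.exists_norm_integral_initial_le (hw : IsBackwardSolution L T g wT w)
    (hL : 0 < L) (hg : AEStronglyMeasurable g (volume.restrict (cylinder L T)))
    (hgw : IntegrableOn (fun p : ℝ × ℝ => ‖g p‖ ^ 2 * Real.exp ((L ^ 2 - p.2 ^ 2) / (2 * p.1)))
      (cylinder L T)) {t₀ : ℝ} (ht₀ : 0 < t₀) (hT : t₀ ≤ T) :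
    ∃ C, 0 ≤ C ∧ ∀ ψ, IsTest L t₀ ψ →
      ‖∫ x in Ioo (-L) L, w 0 x * ψ (0, x)‖ ≤ C * √(observation L t₀ ψ) := by
  obtain ⟨C, hC, hobs⟩ := exists_integral_norm_sq_conj_gaussianWeight_le hL ht₀
  obtain ⟨D, hD⟩ := isCompact_Icc.exists_bound_of_continuousOn (s := Icc 0 t₀)
    ((contDiff_cutoff t₀).continuous_deriv (by simp)).continuousOn
  obtain ⟨B, hB⟩ := isCompact_Icc.exists_bound_of_continuousOn hw.continuousOn
  have hT0 : 0 ≤ T := ht₀.le.trans hT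
  have hB0 : 0 ≤ B := (norm_nonneg _).trans (hB 0 ⟨le_rfl, hT0⟩)
  set M := ∫ p in cylinder L T, ‖g p‖ ^ 2 * Real.exp ((L ^ 2 - p.2 ^ 2) / (2 * p.1))
  set N := 2 * (D ^ 2 * Real.exp (L ^ 2 / t₀) * C + 1)
  refine ⟨√M * √C + B * (√T * √N), by positivity, fun ψ hψ => ?_⟩
  set K := observation L t₀ ψ
  have hsource : ‖∫ p in cylinder L T, g p * truncated t₀ ψ p‖ ≤ √M * (√C * √K) := by
    refine (norm_integral_mul_le_weighted L T hg hgw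
      (contDiff_truncated t₀ hψ.smooth).continuous).trans ?_
    rw [← Real.sqrt_mul hC]
    gcongr
    exact (integral_norm_sq_conj_truncated_le ht₀ hT hψ.smooth.continuous).trans (hobs ψ hψ)
  have hheat : ∫ p in cylinder L T, ‖heat (truncated t₀ ψ) p‖ ^ 2 ≤ N * K := by
    refine (integral_norm_sq_heat_truncated_le ht₀ hT hψ.smooth hD).trans ?_
    calc _ ≤ 2 * (D ^ 2 * Real.exp (L ^ 2 / t₀) * (C * K) + K) := by
          gcongr
          exacts [hobs ψ hψ, integral_heat_le_observation ht₀.le]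
      _ = N * K := by ring
  have hstate : ‖∫ t in Ioo 0 T, ∫ x in Ioo (-L) L, w t x * heat (truncated t₀ ψ) (t, x)‖ ≤
      B * (√T * (√N * √K)) := by
    refine (norm_integral_state_mul_le hT0 hB0 (fun t ht => hB t (Ioo_subset_Icc_self ht))
      (continuous_heat (contDiff_truncated t₀ hψ.smooth))).trans ?_
    rw [← Real.sqrt_mul (by positivity : 0 ≤ N)]
    gcongr
  rw [hw.integral_initial_eq ht₀ hT hψ]
  exact (norm_sub_le _ _).trans ((add_le_add hsource hstate).trans_eq (by ring))

end Reachability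

end HeatReach

end

open HeatReach

theorem lemma2_general (L T : ℝ) (hL : 0 < L) (hT : 0 < T) (g : ℝ × ℝ → ℂ)
    (hg : AEStronglyMeasurable g (volume.restrict (Ioo 0 T ×ˢ Ioo (-L) L)))
    (hgw : IntegrableOn
      (fun p : ℝ × ℝ => ‖g p‖ ^ 2 * Real.exp ((L ^ 2 - p.2 ^ 2) / (2 * p.1)))
      (Ioo 0 T ×ˢ Ioo (-L) L))
    (wT : State L) (w : ℝ → State L) (hw : IsBackwardSolution L T g wT w) :
    w 0 ∈ reachableSet L := by
  refine mem_iInter₂.2 fun τ hτ => ?_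
  have ht₀ : 0 < min τ T := lt_min hτ hT
  obtain ⟨C, hC, hle⟩ := hw.exists_norm_integral_initial_le hL hg hgw ht₀ (min_le_right τ T)
  refine mem_reachableSetAt_of_norm_le (C := C) hL.le hτ.le fun φ hφ => ?_
  have h := hle (reversed τ φ) (hφ.reversed.mono (min_le_left τ T))
  simp only [reversed, sub_zero] at h
  refine h.trans ?_
  gcongr
  exact observation_mono hφ.reversed.smooth ht₀.le (min_le_left τ T)

theorem lemma2 (L T : ℝ) (hL : 0 < L) (hT : L ^ 2 < Real.pi * T)
    (g : ℝ × ℝ → ℂ)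
    (hg : MemLp g 2 (volume.restrict (Ioi 0 ×ˢ Ioo (-L) L)))
    (hgw : IntegrableOn
      (fun p : ℝ × ℝ => ‖g p‖ ^ 2 * Real.exp ((L ^ 2 - p.2 ^ 2) / (2 * p.1)))
      (Ioi 0 ×ˢ Ioo (-L) L))
    (wT : HeatReach.State L) (w : ℝ → HeatReach.State L)
    (hw : HeatReach.IsBackwardSolution L T g wT w) :
    w 0 ∈ HeatReach.reachableSet L := by
  have hTpos : 0 < T := pos_of_mul_pos_right ((sq_nonneg L).trans_lt hT) Real.pi_pos.le
  have hsub : Ioo 0 T ×ˢ Ioo (-L) L ⊆ Ioi 0 ×ˢ Ioo (-L) L :=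
    prod_mono Ioo_subset_Ioi_self subset_rfl
  exact lemma2_general L T hL hTpos g (hg.1.mono_set hsub) (hgw.mono_set hsub) wT w hw
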